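/- Let $(M,g)$ be a spacetime, i.e. a (Hausdorff, second countable) smooth $4$-dimensional manifold with a smooth Lorentzian metric of signature $(-,+,+,+)$ and a time orientation. Write $p\ll q$ if there is a future-directed timelike curve from $p$ to $q$, and for $A\subset M$ let $I^{+}(A)=\{q : p\ll q \text{ for some } p\in A\}$ and $I^{-}(A)=\{q : q\ll p \text{ for some } p\in A\}$. Let $r\in M$ with $r\ll r$, and let $[r]=\{q : r\ll q\ll r\}$ be its chronology violating class. Put $B_f([r])=\overline{[r]}\setminus I^{-}([r])$. Proposition. Assume that the open set $N=M\setminus\overline{I^{-}([r])}$, with the induced metric, is globally hyperbolic, i.e. $N$ contains no closed causal curve and all the sets $J_N^{+}(p)\cap J_N^{-}(q)$, $p,q\in N$, are compact. Let $S\subset N$ be any Cauchy hypersurface of $N$, i.e. a subset of $N$ that every causal curve of $N$, inextendible in $N$, meets exactly once. Then: (1) $S$ is achronal in $M$, and it is edgeless in $M$, i.e. $\mathrm{edge}(S)=\emptyset$. Here $\mathrm{edge}(S)$ is the set of the points $q\in\overline{S}$ such that in every neighbourhood $U$ of $q$ there is a timelike curve that does not meet $S$ and goes from a point of $I^{-}(q,U)$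 to a point of $I^{+}(q,U)$, where $I^{\pm}(q,U)$ are the chronological future and past of $q$ along curves in $U$. (2) $H^{-}(S)=\partial I^{-}([r])$. Here $H^{-}(S)=\overline{D^{-}(S)}\setminus I^{+}(D^{-}(S))$ is the past Cauchy horizon of $S$ in $M$, and $D^{-}(S)$ is the set of the $p\in M$ such that every future inextendible causal curve of $M$ starting at $p$ meets $S$. (3) If, moreover, $M=I^{+}([r])$, then $H^{-}(S)=\partial[r]=B_f([r])$. -/

import Mathlib

open Set Topology
open scoped Manifold ContDiff

/-- A smooth Lorentzian metric of signature `(-,+,+,+)` on a smooth 4-manifold `M`. -/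
structure LorentzMetric (M : Type*) [TopologicalSpace M]
    [ChartedSpace (EuclideanSpace ℝ (Fin 4)) M] [IsManifold (𝓡 4) ∞ M] where
  /-- The bilinear form on each tangent space. -/
  form (x : M) : TangentSpace (𝓡 4) x →L[ℝ] TangentSpace (𝓡 4) x →L[ℝ] ℝ
  symm (x : M) (v w : TangentSpace (𝓡 4) x) : form x v w = form x w v
  /-- Each tangent space has an orthonormal basis for the signature `(-,+,+,+)`. -/
  signature (x : M) : ∃ b : Module.Basis (Fin 4) ℝ (TangentSpace (𝓡 4) x),
    ∀ i j, form x (b i) (b j) = if i = j then (if i = 0 then -1 else 1) else 0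
  contMDiff : ContMDiff (𝓡 4)
    ((𝓡 4).prod 𝓘(ℝ, EuclideanSpace ℝ (Fin 4) →L[ℝ] EuclideanSpace ℝ (Fin 4) →L[ℝ] ℝ)) ∞
    (fun x : M ↦ Bundle.TotalSpace.mk'
      (EuclideanSpace ℝ (Fin 4) →L[ℝ] EuclideanSpace ℝ (Fin 4) →L[ℝ] ℝ) x (form x))

/-- A time-oriented Lorentzian metric: a Lorentzian metric together with a time orientation, given
by a continuous timelike vector field, declared to be future directed. -/
structure SpacetimeMetric (M : Type*) [TopologicalSpace M]
    [ChartedSpace (EuclideanSpace ℝ (Fin 4)) M] [IsManifold (𝓡 4) ∞ M] extends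
    LorentzMetric M where
  /-- The vector field that fixes the time orientation. -/
  orient (x : M) : TangentSpace (𝓡 4) x
  orient_timelike (x : M) : form x (orient x) (orient x) < 0
  orient_continuous :
    Continuous (fun x : M ↦ (⟨x, orient x⟩ : TangentBundle (𝓡 4) M))

namespace SpacetimeMetric

variable {M : Type*} [TopologicalSpace M] [ChartedSpace (EuclideanSpace ℝ (Fin 4)) M]
  [IsManifold (𝓡 4) ∞ M]

/-- Future-directed timelike tangent vectors. -/
def FutureTimelike (g : SpacetimeMetric M) (x : M) (v : TangentSpace (𝓡 4) x) : Prop :=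
  g.form x v v < 0 ∧ g.form x v (g.orient x) < 0

/-- Future-directed causal (timelike or lightlike, nonzero) tangent vectors. -/
def FutureCausal (g : SpacetimeMetric M) (x : M) (v : TangentSpace (𝓡 4) x) : Prop :=
  v ≠ 0 ∧ g.form x v v ≤ 0 ∧ g.form x v (g.orient x) < 0

/-- `γ` is of class `C¹` on `[a, b]` (one-sided at the endpoints), and its velocity at every
parameter of `[a, b]` satisfies `P`. -/
def IsC1Piece (P : ∀ x : M, TangentSpace (𝓡 4) x → Prop) (γ : ℝ → M) (a b : ℝ) : Prop :=
  ContMDiffOn 𝓘(ℝ, ℝ) (𝓡 4) 1 γ (Icc a b) ∧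
    ∀ t ∈ Icc a b, P (γ t) (mfderivWithin 𝓘(ℝ, ℝ) (𝓡 4) γ (Icc a b) t (1 : ℝ))

/-- `γ` restricts to a piecewise `C¹` curve on the nondegenerate interval `J` (of any kind), all of
whose one-sided velocities satisfy `P`.  Between any two parameters `t < u` of `J`, the curve is
`C¹` on some interval starting at `t` and on some interval ending at `u`; by compactness this is to
say that every compact subinterval of `J` splits into finitely many intervals on which `γ` is
`C¹`. -/
def IsPiecewiseC1Curve (P : ∀ x : M, TangentSpace (𝓡 4) x → Prop) (γ : ℝ → M) (J : Set ℝ) :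
    Prop :=
  J.OrdConnected ∧ J.Nontrivial ∧ ∀ t ∈ J, ∀ u ∈ J, t < u →
    (∃ s ∈ Ioc t u, IsC1Piece P γ t s) ∧ (∃ s ∈ Ico t u, IsC1Piece P γ s u)

/-- Future-directed timelike curves. -/
def IsTimelikeCurve (g : SpacetimeMetric M) (γ : ℝ → M) (J : Set ℝ) : Prop :=
  IsPiecewiseC1Curve g.FutureTimelike γ J

/-- Future-directed causal curves. -/
def IsCausalCurve (g : SpacetimeMetric M) (γ : ℝ → M) (J : Set ℝ) : Prop :=
  IsPiecewiseC1Curve g.FutureCausal γ J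

/-- `p ≪ q` relative to `U`: some future-directed timelike curve inside `U` goes from `p` to `q`.
For open `U` this is the chronology relation of the spacetime `U` with the induced metric, as the
curves of the open submanifold `U` are the curves of `M` with values in `U`. -/
def ChronIn (g : SpacetimeMetric M) (U : Set M) (p q : M) : Prop :=
  ∃ (γ : ℝ → M) (a b : ℝ), a < b ∧ g.IsTimelikeCurve γ (Icc a b) ∧ MapsTo γ (Icc a b) U ∧
    γ a = p ∧ γ b = q

/-- Some future-directed causal curve inside `U` goes from `p` to `q`. -/
def CausalIn (g : SpacetimeMetric M) (U : Set M) (p q : M) : Prop :=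
  ∃ (γ : ℝ → M) (a b : ℝ), a < b ∧ g.IsCausalCurve γ (Icc a b) ∧ MapsTo γ (Icc a b) U ∧
    γ a = p ∧ γ b = q

/-- The chronology relation `p ≪ q` of `M`. -/
def Chron (g : SpacetimeMetric M) (p q : M) : Prop := g.ChronIn univ p q

/-- The chronological future `I⁺(A)` in `M`. -/
def chronFuture (g : SpacetimeMetric M) (A : Set M) : Set M := {q | ∃ p ∈ A, g.Chron p q}

/-- The chronological past `I⁻(A)` in `M`. -/
def chronPast (g : SpacetimeMetric M) (A : Set M) : Set M := {q | ∃ p ∈ A, g.Chron q p}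

/-- The class `[r]` of `r` for the relation `p ≪ q ≪ p`; it is a chronology violating class
when `r ≪ r`. -/
def chronClass (g : SpacetimeMetric M) (r : M) : Set M := {q | g.Chron r q ∧ g.Chron q r}

/-- The future boundary `B_f([r])` of a chronology violating class. -/
def futureBoundary (g : SpacetimeMetric M) (r : M) : Set M :=
  closure (g.chronClass r) \ g.chronPast (g.chronClass r)

/-- The causal relation `p ≤ q` relative to `U` (for `p, q ∈ U`). -/
def CausalLEIn (g : SpacetimeMetric M) (U : Set M) (p q : M) : Prop :=
  p = q ∨ g.CausalIn U p q

/-- The open set `U`, as a spacetime with the induced metric, is globally hyperbolic: it has no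
closed causal curve and the causal diamonds `J⁺(p) ∩ J⁻(q)` of `U` are compact. -/
def IsGloballyHyperbolic (g : SpacetimeMetric M) (U : Set M) : Prop :=
  (∀ p ∈ U, ¬ g.CausalIn U p p) ∧
    ∀ p ∈ U, ∀ q ∈ U, IsCompact {x | x ∈ U ∧ g.CausalLEIn U p x ∧ g.CausalLEIn U x q}

/-- `q` is a future endpoint of the curve `γ` with parameter interval `J`. -/
def IsFutureEndpoint (γ : ℝ → M) (J : Set ℝ) (q : M) : Prop :=
  ∀ V ∈ 𝓝 q, ∃ t₀ ∈ J, ∀ t ∈ J, t₀ ≤ t → γ t ∈ V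

/-- `q` is a past endpoint of the curve `γ` with parameter interval `J`. -/
def IsPastEndpoint (γ : ℝ → M) (J : Set ℝ) (q : M) : Prop :=
  ∀ V ∈ 𝓝 q, ∃ t₀ ∈ J, ∀ t ∈ J, t ≤ t₀ → γ t ∈ V

/-- `S` is a Cauchy hypersurface of the open set `U` with the induced metric: a subset of `U` that
every causal curve of `U`, inextendible in `U`, meets exactly once. -/
def IsCauchyHypersurface (g : SpacetimeMetric M) (U S : Set M) : Prop :=
  S ⊆ U ∧ ∀ (γ : ℝ → M) (J : Set ℝ), g.IsCausalCurve γ J → MapsTo γ J U →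
    (∀ q ∈ U, ¬ IsFutureEndpoint γ J q ∧ ¬ IsPastEndpoint γ J q) → ∃! t, t ∈ J ∧ γ t ∈ S

/-- `S` is achronal in `M`: no two points of `S` are chronologically related. -/
def Achronal (g : SpacetimeMetric M) (S : Set M) : Prop :=
  ∀ p ∈ S, ∀ q ∈ S, ¬ g.Chron p q

/-- The edge in `M` of an achronal set `S`: the points `q` of the closure of `S` such that, in every
neighbourhood `U` of `q`, some timelike curve that does not meet `S` goes from a point of
`I⁻(q, U)` to a point of `I⁺(q, U)`. -/
def edge (g : SpacetimeMetric M) (S : Set M) : Set M :=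
  {q | q ∈ closure S ∧ ∀ U ∈ 𝓝 q, ∃ x y, g.ChronIn U x q ∧ g.ChronIn U q y ∧ g.ChronIn (U \ S) x y}

/-- The past domain of dependence `D⁻(S)` in `M`: the points `p` such that every causal curve of `M`
that starts at `p` and is future inextendible in `M` meets `S`. -/
def pastDependence (g : SpacetimeMetric M) (S : Set M) : Set M :=
  {p | ∀ (γ : ℝ → M) (J : Set ℝ) (a : ℝ), IsLeast J a → γ a = p → g.IsCausalCurve γ J →
    (∀ q, ¬ IsFutureEndpoint γ J q) → ∃ t ∈ J, γ t ∈ S}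

/-- The past Cauchy horizon `H⁻(S)` in `M`. -/
def pastHorizon (g : SpacetimeMetric M) (S : Set M) : Set M :=
  closure (g.pastDependence S) \ g.chronFuture (g.pastDependence S)

end SpacetimeMetric

/-!
The argument is pure causality theory for the open past set `P = I⁻([r])` and the open set
`N = M \ closure P`.

Two local facts, both proved in a chart, carry everything. First, `p ≪ q` is an open condition in
`p` and in `q` (`ChronIn.eventually_left`, `ChronIn.eventually_right`), because straight coordinate
segments close to a timelike direction are timelike. Second, the end point of a short causal curve
is in the chronological future of points arbitrarily close to its starting point
(`exists_chron_of_isC1Piece`); this uses that the metric is locally Lipschitz. Openness shows that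
`x ≪ y ∈ closure P` forces `x ∈ P`, and with the second fact, applied at a first entry point, it
follows that causal curves which start in `N` stay in `N`
(`IsCausalCurve.notMem_closure_chronPast`).

Inextendible timelike curves are constructed without geodesics or flows: a chain `p₀ ≪ p₁ ≪ ⋯` in
an open set whose steps are at least half as long as possible has no limit there
(`exists_seq_without_limit`), and a chain is traced by a single timelike curve
(`exists_isTimelikeCurve_of_seqs`).

For a Cauchy hypersurface `S` of `N`: a timelike curve of `M` between two points of `S` would stay
in `N` and extend there to an inextendible curve that meets `S` twice, so `S` is achronal. From a
point of `∂P` there starts a timelike curve that enters `N` at once and meets `S`; as the past of a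
point of `S` contains no point of the closure of `S`, it follows that the closure of `S` avoids
`∂P`. In the same way `S` is closed, and a timelike curve as in the definition of the edge would,
extended in `N`, meet `S` outside of the given segment, against achronality. Points `x ∈ N`
with `x ≪ s ∈ S` belong to `D⁻(S)`: a future inextendible causal curve from `x` stays in `N`, and becomes
inextendible in `N` after adding a timelike past of `x`, where it cannot meet `S`. On the other
hand `D⁻(S)` does not meet `P`, since from every point of `P` a timelike curve runs to `r` and then
goes around forever through `r` and a second point of `[r]`, within `P` and without an endpoint.
These two statements give `H⁻(S) = ∂P`. If `M = I⁺([r])`, then `P = [r]`, which is open, and the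
rest is topology.
-/

namespace SpacetimeMetric

variable {M : Type*} [TopologicalSpace M] [ChartedSpace (EuclideanSpace ℝ (Fin 4)) M]

/-! ### Piecewise `C¹` curves: restriction, reparametrization, gluing -/

section Curves

variable {P : ∀ x : M, TangentSpace (𝓡 4) x → Prop}

/-- Transport of a condition on tangent vectors along equalities of base points and of vectors; all
tangent spaces are the model space `EuclideanSpace ℝ (Fin 4)`. -/
lemma velocity_transport {x y : M} (h : x = y) {v w : EuclideanSpace ℝ (Fin 4)} (hv : v = w)
    (H : P x v) : P y w := by
  subst h; subst hv; exact H

lemma IsC1Piece.congr {γ γ' : ℝ → M} {a b : ℝ} (h : IsC1Piece P γ a b)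
    (he : EqOn γ' γ (Icc a b)) : IsC1Piece P γ' a b := by
  refine ⟨h.1.congr he, fun t ht ↦ ?_⟩
  refine velocity_transport (he ht).symm ?_ (h.2 t ht)
  exact congrArg (fun L : ℝ →L[ℝ] EuclideanSpace ℝ (Fin 4) ↦ L 1)
    (mfderivWithin_congr (fun x hx ↦ he hx) (he ht)).symm

lemma nontrivial_Icc {a b : ℝ} (hab : a < b) : (Icc a b).Nontrivial :=
  ⟨a, left_mem_Icc.2 hab.le, b, right_mem_Icc.2 hab.le, hab.ne⟩

lemma uniqueMDiffWithinAt_Icc {a b t : ℝ} (hab : a < b) (ht : t ∈ Icc a b) :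
    UniqueMDiffWithinAt 𝓘(ℝ, ℝ) (Icc a b) t :=
  ((uniqueDiffOn_Icc hab) t ht).uniqueMDiffWithinAt

lemma IsC1Piece.mono {γ : ℝ → M} {a b c d : ℝ} (h : IsC1Piece P γ a b)
    (hcd : c < d) (hac : a ≤ c) (hdb : d ≤ b) : IsC1Piece P γ c d := by
  have hsub : Icc c d ⊆ Icc a b := Icc_subset_Icc hac hdb
  refine ⟨h.1.mono hsub, fun t ht ↦ ?_⟩
  refine velocity_transport rfl ?_ (h.2 t (hsub ht))
  exact congrArg (fun L : ℝ →L[ℝ] EuclideanSpace ℝ (Fin 4) ↦ L 1)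
    (mfderivWithin_subset hsub (uniqueMDiffWithinAt_Icc hcd ht)
      ((h.1 t (hsub ht)).mdifferentiableWithinAt (by norm_num))).symm

lemma IsC1Piece.comp_affine (hP : ∀ x v (c : ℝ), 0 < c → P x v → P x (c • v)) {γ : ℝ → M}
    {a b c d : ℝ} (hc : 0 < c) (hab : a < b) (h : IsC1Piece P γ (c * a + d) (c * b + d)) :
    IsC1Piece P (fun t ↦ γ (c * t + d)) a b := by
  have hm : MapsTo (fun t : ℝ ↦ c * t + d) (Icc a b) (Icc (c * a + d) (c * b + d)) := by
    intro t ht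
    constructor <;> nlinarith [ht.1, ht.2]
  have hs : ContMDiff 𝓘(ℝ, ℝ) 𝓘(ℝ, ℝ) 1 (fun t : ℝ ↦ c * t + d) := by
    apply ContDiff.contMDiff
    fun_prop
  refine ⟨h.1.comp hs.contMDiffOn hm, fun t ht ↦ ?_⟩
  refine velocity_transport rfl ?_ (hP _ _ c hc (h.2 _ (hm ht)))
  have h1 := mfderivWithin_comp t ((h.1 _ (hm ht)).mdifferentiableWithinAt (by norm_num))
    ((hs.contMDiffOn (s := Icc a b) t ht).mdifferentiableWithinAt (by norm_num)) hm.subset_preimage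
    (uniqueMDiffWithinAt_Icc hab ht)
  have h2 : mfderivWithin 𝓘(ℝ, ℝ) 𝓘(ℝ, ℝ) (fun t : ℝ ↦ c * t + d) (Icc a b) t (1 : ℝ) = c := by
    rw [mfderivWithin_eq_fderivWithin]
    have : HasDerivWithinAt (fun t : ℝ ↦ c * t + d) c (Icc a b) t := by
      simpa using ((hasDerivAt_id t).const_mul c |>.add_const d).hasDerivWithinAt
    exact this.derivWithin (uniqueDiffOn_Icc hab t ht)
  have h3 := congrArg (fun L : ℝ →L[ℝ] EuclideanSpace ℝ (Fin 4) ↦ L 1) h1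
  refine Eq.trans ?_ h3.symm
  change _ = mfderivWithin 𝓘(ℝ, ℝ) (𝓡 4) γ (Icc (c * a + d) (c * b + d)) (c * t + d)
    (mfderivWithin 𝓘(ℝ, ℝ) 𝓘(ℝ, ℝ) (fun t : ℝ ↦ c * t + d) (Icc a b) t (1 : ℝ))
  rw [h2]
  have := (mfderivWithin 𝓘(ℝ, ℝ) (𝓡 4) γ (Icc (c * a + d) (c * b + d)) (c * t + d)).map_smul c
    (1 : ℝ)
  rw [← this]
  congr 1
  exact mul_one c

lemma IsPiecewiseC1Curve.mono {γ : ℝ → M} {J J' : Set ℝ} (h : IsPiecewiseC1Curve P γ J)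
    (hsub : J' ⊆ J) (ho : J'.OrdConnected) (hn : J'.Nontrivial) : IsPiecewiseC1Curve P γ J' :=
  ⟨ho, hn, fun t ht u hu htu ↦ h.2.2 t (hsub ht) u (hsub hu) htu⟩

lemma IsPiecewiseC1Curve.continuousOn {γ : ℝ → M} {J : Set ℝ} (h : IsPiecewiseC1Curve P γ J) :
    ContinuousOn γ J := by
  intro u hu
  have hl : ContinuousWithinAt γ (J ∩ Iic u) u := by
    by_cases hex : ∃ t ∈ J, t < u
    · obtain ⟨t, ht, htu⟩ := hex
      obtain ⟨s, hs, hp⟩ := (h.2.2 t ht u hu htu).2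
      have := hp.1.continuousOn u (right_mem_Icc.2 hs.2.le)
      rw [ContinuousWithinAt, nhdsWithin_Icc_eq_nhdsLE hs.2] at this
      exact ContinuousWithinAt.mono this inter_subset_right
    · push Not at hex
      refine continuousWithinAt_singleton.mono fun t ht ↦ ?_
      exact le_antisymm ht.2 (hex t ht.1)
  have hr : ContinuousWithinAt γ (J ∩ Ici u) u := by
    by_cases hex : ∃ t ∈ J, u < t
    · obtain ⟨t, ht, htu⟩ := hex
      obtain ⟨s, hs, hp⟩ := (h.2.2 u hu t ht htu).1
      have := hp.1.continuousOn u (left_mem_Icc.2 hs.1.le)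
      rw [ContinuousWithinAt, nhdsWithin_Icc_eq_nhdsGE hs.1] at this
      exact ContinuousWithinAt.mono this inter_subset_right
    · push Not at hex
      refine continuousWithinAt_singleton.mono fun t ht ↦ ?_
      exact le_antisymm (hex t ht.1) ht.2
  refine (hl.union hr).mono fun t ht ↦ ?_
  rcases le_total t u with htu | htu
  · exact Or.inl ⟨ht, htu⟩
  · exact Or.inr ⟨ht, htu⟩

lemma IsPiecewiseC1Curve.congr {γ γ' : ℝ → M} {J : Set ℝ} (h : IsPiecewiseC1Curve P γ J)
    (he : EqOn γ' γ J) : IsPiecewiseC1Curve P γ' J := by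
  refine ⟨h.1, h.2.1, fun t ht u hu htu ↦ ?_⟩
  obtain ⟨⟨s, hs, h1⟩, s', hs', h2⟩ := h.2.2 t ht u hu htu
  have hJ := h.1.out ht hu
  exact ⟨⟨s, hs, h1.congr (he.mono ((Icc_subset_Icc_right hs.2).trans hJ))⟩,
    s', hs', h2.congr (he.mono ((Icc_subset_Icc_left hs'.1).trans hJ))⟩

lemma IsC1Piece.isPiecewiseC1Curve {γ : ℝ → M} {a b : ℝ} (hab : a < b)
    (h : IsC1Piece P γ a b) : IsPiecewiseC1Curve P γ (Icc a b) :=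
  ⟨ordConnected_Icc, nontrivial_Icc hab, fun t ht u hu htu ↦
    ⟨⟨u, ⟨htu, le_rfl⟩, h.mono htu ht.1 hu.2⟩, t, ⟨le_rfl, htu⟩, h.mono htu ht.1 hu.2⟩⟩

lemma IsPiecewiseC1Curve.imp {Q : ∀ x : M, TangentSpace (𝓡 4) x → Prop}
    (hPQ : ∀ x v, P x v → Q x v) {γ : ℝ → M} {J : Set ℝ} (h : IsPiecewiseC1Curve P γ J) :
    IsPiecewiseC1Curve Q γ J := by
  refine ⟨h.1, h.2.1, fun t ht u hu htu ↦ ?_⟩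
  obtain ⟨⟨s, hs, h1⟩, s', hs', h2⟩ := h.2.2 t ht u hu htu
  exact ⟨⟨s, hs, h1.1, fun x hx ↦ hPQ _ _ (h1.2 x hx)⟩,
    s', hs', h2.1, fun x hx ↦ hPQ _ _ (h2.2 x hx)⟩

lemma IsPiecewiseC1Curve.comp_affine (hP : ∀ x v (c : ℝ), 0 < c → P x v → P x (c • v))
    {γ : ℝ → M} {J J' : Set ℝ} {c d : ℝ} (hc : 0 < c) (ho : J'.OrdConnected)
    (hn : J'.Nontrivial) (hm : MapsTo (fun t ↦ c * t + d) J' J) (h : IsPiecewiseC1Curve P γ J) :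
    IsPiecewiseC1Curve P (fun t ↦ γ (c * t + d)) J' := by
  refine ⟨ho, hn, fun t ht u hu htu ↦ ?_⟩
  obtain ⟨⟨s, hs, h1⟩, s', hs', h2⟩ := h.2.2 _ (hm ht) _ (hm hu)
    (add_lt_add_left (mul_lt_mul_of_pos_left htu hc) d)
  have e : ∀ s : ℝ, c * ((s - d) / c) + d = s := fun s ↦ by field_simp; ring
  have l1 : t < (s - d) / c := by rw [lt_div_iff₀ hc]; linarith [hs.1]
  have l2 : (s - d) / c ≤ u := by rw [div_le_iff₀ hc]; linarith [hs.2]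
  have l3 : t ≤ (s' - d) / c := by rw [le_div_iff₀ hc]; linarith [hs'.1]
  have l4 : (s' - d) / c < u := by rw [div_lt_iff₀ hc]; linarith [hs'.2]
  exact ⟨⟨(s - d) / c, ⟨l1, l2⟩, IsC1Piece.comp_affine hP hc l1 (by rwa [e])⟩,
    (s' - d) / c, ⟨l3, l4⟩, IsC1Piece.comp_affine hP hc l4 (by rwa [e])⟩

lemma IsPiecewiseC1Curve.glue {γ₁ γ₂ : ℝ → M} {J₁ J₂ : Set ℝ} {a : ℝ}
    (h₁ : IsPiecewiseC1Curve P γ₁ J₁) (h₂ : IsPiecewiseC1Curve P γ₂ J₂) (ha₁ : IsGreatest J₁ a)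
    (ha₂ : IsLeast J₂ a) (he : γ₁ a = γ₂ a) :
    IsPiecewiseC1Curve P (fun t ↦ if t ≤ a then γ₁ t else γ₂ t) (J₁ ∪ J₂) := by
  set γ : ℝ → M := fun t ↦ if t ≤ a then γ₁ t else γ₂ t with hγ
  have e1 : ∀ t, t ≤ a → γ t = γ₁ t := fun t ht ↦ if_pos ht
  have e2 : ∀ t, a ≤ t → γ t = γ₂ t := by
    intro t ht
    rcases ht.eq_or_lt with rfl | ht
    · rw [e1 _ le_rfl, he]
    · exact if_neg (not_le.2 ht)
  have m1 : ∀ t ∈ J₁ ∪ J₂, t ≤ a → t ∈ J₁ := by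
    rintro t (ht | ht) hta
    · exact ht
    · rw [le_antisymm hta (ha₂.2 ht)]; exact ha₁.1
  have m2 : ∀ t ∈ J₁ ∪ J₂, a ≤ t → t ∈ J₂ := by
    rintro t (ht | ht) hta
    · rw [le_antisymm (ha₁.2 ht) hta]; exact ha₂.1
    · exact ht
  refine ⟨⟨fun t ht u hu x hx ↦ ?_⟩, h₁.2.1.mono subset_union_left, fun t ht u hu htu ↦ ⟨?_, ?_⟩⟩
  · rcases le_total x a with hxa | hxa
    · exact Or.inl (h₁.1.out (m1 t ht (hx.1.trans hxa)) ha₁.1 ⟨hx.1, hxa⟩)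
    · exact Or.inr (h₂.1.out ha₂.1 (m2 u hu (hxa.trans hx.2)) ⟨hxa, hx.2⟩)
  · rcases lt_or_ge t a with hta | hta
    · obtain ⟨s, hs, h⟩ := (h₁.2.2 t (m1 t ht hta.le) a ha₁.1 hta).1
      have hm : min s u ≤ s := min_le_left _ _
      refine ⟨min s u, ⟨lt_min hs.1 htu, min_le_right _ _⟩,
        (h.mono (lt_min hs.1 htu) le_rfl hm).congr fun x hx ↦ e1 x (hx.2.trans (hm.trans hs.2))⟩
    · obtain ⟨s, hs, h⟩ := (h₂.2.2 t (m2 t ht hta) u (m2 u hu (hta.trans htu.le)) htu).1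
      exact ⟨s, hs, h.congr fun x hx ↦ e2 x (hta.trans hx.1)⟩
  · rcases le_or_gt u a with hua | hua
    · obtain ⟨s, hs, h⟩ := (h₁.2.2 t (m1 t ht (htu.le.trans hua)) u (m1 u hu hua) htu).2
      exact ⟨s, hs, h.congr fun x hx ↦ e1 x (hx.2.trans hua)⟩
    · obtain ⟨s, hs, h⟩ := (h₂.2.2 a ha₂.1 u (m2 u hu hua.le) hua).2
      have hm : s ≤ max s t := le_max_left _ _
      exact ⟨max s t, ⟨le_max_right _ _, max_lt hs.2 htu⟩,
        (h.mono (max_lt hs.2 htu) hm le_rfl).congr fun x hx ↦ e2 x (hs.1.trans (hm.trans hx.1))⟩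

/-- Piecewise `C¹` curves on the intervals `[n, n + 1]`, `n ∈ ℤ`, whose ends fit together, form a
piecewise `C¹` curve on the real line. -/
lemma isPiecewiseC1Curve_univ_of_int {σ : ℤ → ℝ → M} {γ : ℝ → M}
    (hσ : ∀ n : ℤ, IsPiecewiseC1Curve P (σ n) (Icc n (n + 1)))
    (hγ : ∀ n : ℤ, EqOn γ (σ n) (Icc n (n + 1))) : IsPiecewiseC1Curve P γ univ := by
  refine ⟨ordConnected_univ, nontrivial_univ, fun t _ u _ htu ↦ ⟨?_, ?_⟩⟩
  · have h := (hσ ⌊t⌋).congr (hγ ⌊t⌋)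
    have l1 := Int.floor_le t
    have l2 := Int.lt_floor_add_one t
    obtain ⟨s, hs, h⟩ := (h.2.2 t ⟨l1, l2.le⟩ (⌊t⌋ + 1) ⟨by linarith, le_rfl⟩ l2).1
    exact ⟨min s u, ⟨lt_min hs.1 htu, min_le_right _ _⟩,
      h.mono (lt_min hs.1 htu) le_rfl (min_le_left _ _)⟩
  · have l1 := Int.le_ceil u
    have l2 := Int.ceil_lt_add_one u
    have h := (hσ (⌈u⌉ - 1)).congr (hγ (⌈u⌉ - 1))
    push_cast at h
    rw [sub_add_cancel] at h
    obtain ⟨s, hs, h⟩ := (h.2.2 (⌈u⌉ - 1) ⟨le_rfl, by linarith⟩ u ⟨by linarith, l1⟩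
      (by linarith)).2
    exact ⟨max s t, ⟨le_max_right _ _, max_lt hs.2 htu⟩,
      h.mono (max_lt hs.2 htu) (le_max_left _ _) le_rfl⟩

end Curves

/-! ### The chronology relation -/

variable [IsManifold (𝓡 4) ∞ M] {g : SpacetimeMetric M}

lemma FutureTimelike.smul {x : M} {v : TangentSpace (𝓡 4) x} {c : ℝ} (hc : 0 < c)
    (h : g.FutureTimelike x v) : g.FutureTimelike x (c • v) := by
  obtain ⟨h1, h2⟩ := h
  constructor
  · simp only [map_smul, smul_apply, smul_eq_mul]
    have := mul_pos hc hc
    nlinarith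
  · simp only [map_smul, smul_apply, smul_eq_mul]
    nlinarith

lemma FutureTimelike.futureCausal {x : M} {v : TangentSpace (𝓡 4) x}
    (h : g.FutureTimelike x v) : g.FutureCausal x v := by
  refine ⟨?_, h.1.le, h.2⟩
  rintro rfl
  simpa using h.1

lemma IsTimelikeCurve.isCausalCurve {γ : ℝ → M} {J : Set ℝ} (h : g.IsTimelikeCurve γ J) :
    g.IsCausalCurve γ J :=
  h.imp fun _ _ ↦ FutureTimelike.futureCausal

lemma ChronIn.mono {U V : Set M} (hUV : U ⊆ V) {p q : M} (h : g.ChronIn U p q) :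
    g.ChronIn V p q := by
  obtain ⟨γ, a, b, hab, hγ, hm, h⟩ := h
  exact ⟨γ, a, b, hab, hγ, hm.mono_right hUV, h⟩

lemma ChronIn.chron {U : Set M} {p q : M} (h : g.ChronIn U p q) : g.Chron p q :=
  h.mono (subset_univ U)

/-- A timelike curve may be reparametrized affinely to any prescribed interval. -/
lemma ChronIn.exists_curve_Icc {U : Set M} {p q : M} (h : g.ChronIn U p q) {c d : ℝ}
    (hcd : c < d) : ∃ γ : ℝ → M, g.IsTimelikeCurve γ (Icc c d) ∧ MapsTo γ (Icc c d) U ∧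
      γ c = p ∧ γ d = q := by
  obtain ⟨γ, a, b, hab, hγ, hm, rfl, rfl⟩ := h
  have hk : 0 < (b - a) / (d - c) := div_pos (sub_pos.2 hab) (sub_pos.2 hcd)
  set k := (b - a) / (d - c) with hkdef
  have e1 : k * c + (a - k * c) = a := by ring
  have e2 : k * d + (a - k * c) = b := by
    have : k * (d - c) = b - a := by
      rw [hkdef]; exact div_mul_cancel₀ _ (sub_pos.2 hcd).ne'
    linarith
  have hmaps : MapsTo (fun t ↦ k * t + (a - k * c)) (Icc c d) (Icc a b) := by
    intro t ht
    have := mul_le_mul_of_nonneg_left ht.1 hk.le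
    have := mul_le_mul_of_nonneg_left ht.2 hk.le
    constructor <;> linarith
  exact ⟨fun t ↦ γ (k * t + (a - k * c)), IsPiecewiseC1Curve.comp_affine
    (fun x v c hc ↦ FutureTimelike.smul hc) hk ordConnected_Icc (nontrivial_Icc hcd) hmaps hγ,
    hm.comp hmaps, by simp only [e1], by simp only [e2]⟩

lemma ChronIn.trans {U : Set M} {p q z : M} (h₁ : g.ChronIn U p q) (h₂ : g.ChronIn U q z) :
    g.ChronIn U p z := by
  obtain ⟨γ₁, c₁, m₁, rfl, e₁⟩ := h₁.exists_curve_Icc (zero_lt_one (α := ℝ))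
  obtain ⟨γ₂, c₂, m₂, e₂, rfl⟩ := h₂.exists_curve_Icc (one_lt_two (α := ℝ))
  have h := IsPiecewiseC1Curve.glue c₁ c₂ (isGreatest_Icc zero_le_one) (isLeast_Icc one_le_two)
    (e₁.trans e₂.symm)
  rw [Icc_union_Icc_eq_Icc zero_le_one one_le_two] at h
  refine ⟨_, 0, 2, two_pos, h, fun t ht ↦ ?_, by simp, by simp⟩
  rcases le_or_gt t 1 with h1 | h1
  · simpa [h1] using m₁ ⟨ht.1, h1⟩
  · simpa [not_le.2 h1] using m₂ ⟨h1.le, ht.2⟩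

lemma Chron.trans {p q z : M} (h₁ : g.Chron p q) (h₂ : g.Chron q z) : g.Chron p z :=
  ChronIn.trans h₁ h₂

lemma IsTimelikeCurve.chron {γ : ℝ → M} {J : Set ℝ} (h : g.IsTimelikeCurve γ J) {t u : ℝ}
    (ht : t ∈ J) (hu : u ∈ J) (htu : t < u) : g.Chron (γ t) (γ u) :=
  ⟨γ, t, u, htu, IsPiecewiseC1Curve.mono h (h.1.out ht hu) ordConnected_Icc
    (nontrivial_Icc htu), mapsTo_univ _ _, rfl, rfl⟩

/-- A bi-infinite chain `⋯ ≪ p (-1) ≪ p 0 ≪ p 1 ≪ ⋯` is traced by one timelike curve. -/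
lemma exists_isTimelikeCurve_of_chain {p : ℤ → M} {U : ℤ → Set M}
    (h : ∀ n, g.ChronIn (U n) (p n) (p (n + 1))) :
    ∃ γ : ℝ → M, g.IsTimelikeCurve γ univ ∧ (∀ n : ℤ, γ n = p n) ∧
      ∀ n : ℤ, MapsTo γ (Icc n (n + 1)) (U n) := by
  choose σ hσ hm h0 h1 using fun n : ℤ ↦ (h n).exists_curve_Icc (lt_add_one (n : ℝ))
  have key : ∀ n : ℤ, EqOn (fun t : ℝ ↦ σ ⌊t⌋ t) (σ n) (Icc n (n + 1)) := by
    intro n t ht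
    rcases ht.2.eq_or_lt with e | hlt
    · have hf : ⌊t⌋ = n + 1 := by rw [e]; exact_mod_cast Int.floor_intCast (R := ℝ) (n + 1)
      have := h0 (n + 1)
      push_cast at this
      simp only [hf]
      rw [e, this, h1]
    · have hf : ⌊t⌋ = n := Int.floor_eq_iff.2 ⟨ht.1, hlt⟩
      simp only [hf]
  refine ⟨fun t ↦ σ ⌊t⌋ t, isPiecewiseC1Curve_univ_of_int hσ key, fun n ↦ ?_, fun n t ht ↦ ?_⟩
  · simp [h0]
  · rw [key n ht]; exact hm n ht

end SpacetimeMetric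

namespace SpacetimeMetric

variable {M : Type*} [TopologicalSpace M] [ChartedSpace (EuclideanSpace ℝ (Fin 4)) M]
  [IsManifold (𝓡 4) ∞ M] (g : SpacetimeMetric M)

/-! ### The metric in a chart -/

/-- The coordinates of a tangent vector at `x` in the chart at `q`, for `x` in the domain of the
chart: the derivative of the chart, given by the trivialization of the tangent bundle; zero
elsewhere. -/
noncomputable def coordVec (q x : M) : TangentSpace (𝓡 4) x →L[ℝ] EuclideanSpace ℝ (Fin 4) :=
  (trivializationAt (EuclideanSpace ℝ (Fin 4)) (TangentSpace (𝓡 4)) q).continuousLinearMapAt ℝ x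

/-- The matrix of the metric in the chart at `q`, as a bilinear form that depends on the coordinates
of the point. -/
noncomputable def coordForm (q : M) (y : EuclideanSpace ℝ (Fin 4)) :
    EuclideanSpace ℝ (Fin 4) →L[ℝ] EuclideanSpace ℝ (Fin 4) →L[ℝ] ℝ :=
  ContinuousLinearMap.inCoordinates (EuclideanSpace ℝ (Fin 4)) (TangentSpace (𝓡 4))
    (EuclideanSpace ℝ (Fin 4) →L[ℝ] ℝ) (fun x : M ↦ TangentSpace (𝓡 4) x →L[ℝ] ℝ)
    q ((extChartAt (𝓡 4) q).symm y) q ((extChartAt (𝓡 4) q).symm y)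
    (g.form ((extChartAt (𝓡 4) q).symm y))

/-- The orienting vector field in the chart at `q`. -/
noncomputable def coordOrient (q : M) (y : EuclideanSpace ℝ (Fin 4)) : EuclideanSpace ℝ (Fin 4) :=
  coordVec q ((extChartAt (𝓡 4) q).symm y) (g.orient ((extChartAt (𝓡 4) q).symm y))

lemma form_eq_coordForm {q x : M} (hx : x ∈ (extChartAt (𝓡 4) q).source)
    (v w : TangentSpace (𝓡 4) x) :
    g.form x v w = g.coordForm q (extChartAt (𝓡 4) q x) (coordVec q x v) (coordVec q x w) := by
  have hx' : x ∈ (trivializationAt (EuclideanSpace ℝ (Fin 4)) (TangentSpace (𝓡 4)) q).baseSet := by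
    simpa using hx
  unfold coordForm
  rw [(extChartAt (𝓡 4) q).left_inv hx]
  rw [inCoordinates_apply_eq₂ hx' hx' (Set.mem_univ _)]
  have e : ∀ u : TangentSpace (𝓡 4) x, (trivializationAt (EuclideanSpace ℝ (Fin 4))
      (TangentSpace (𝓡 4)) q).symm x (coordVec q x u) = u := fun u ↦
    ((trivializationAt (EuclideanSpace ℝ (Fin 4))
      (TangentSpace (𝓡 4)) q).symmL_apply (R := ℝ) hx' _).symm.trans
    ((trivializationAt (EuclideanSpace ℝ (Fin 4))
      (TangentSpace (𝓡 4)) q).symmL_continuousLinearMapAt (R := ℝ) hx' u)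
  rw [e, e]
  simp

lemma orient_eq_coordOrient {q x : M} (hx : x ∈ (extChartAt (𝓡 4) q).source) :
    coordVec q x (g.orient x) = g.coordOrient q (extChartAt (𝓡 4) q x) := by
  unfold coordOrient
  rw [(extChartAt (𝓡 4) q).left_inv hx]

lemma contDiffOn_coordForm (q : M) :
    ContDiffOn ℝ 1 (g.coordForm q) (extChartAt (𝓡 4) q).target := by
  rw [← contMDiffOn_iff_contDiffOn]
  have h : ContMDiffOn (𝓡 4)
      𝓘(ℝ, EuclideanSpace ℝ (Fin 4) →L[ℝ] EuclideanSpace ℝ (Fin 4) →L[ℝ] ℝ) 1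
      (fun x : M ↦ ContinuousLinearMap.inCoordinates (EuclideanSpace ℝ (Fin 4))
        (TangentSpace (𝓡 4)) (EuclideanSpace ℝ (Fin 4) →L[ℝ] ℝ)
        (fun x : M ↦ TangentSpace (𝓡 4) x →L[ℝ] ℝ) q x q x (g.form x))
      (extChartAt (𝓡 4) q).source := by
    have hsec := (Bundle.Trivialization.contMDiffOn_section_iff (IB := 𝓡 4) (n := ∞)
      (s := fun x : M ↦ g.form x)
      (trivializationAt (EuclideanSpace ℝ (Fin 4) →L[ℝ] EuclideanSpace ℝ (Fin 4) →L[ℝ] ℝ)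
        (fun x : M ↦ TangentSpace (𝓡 4) x →L[ℝ] TangentSpace (𝓡 4) x →L[ℝ] ℝ) q)
      (isOpen_extChartAt_source (I := 𝓡 4) q) (by simp)).1 g.contMDiff.contMDiffOn
    exact hsec.of_le (by norm_cast)
  exact h.comp (contMDiffOn_extChartAt_symm q) fun y hy ↦ (extChartAt (𝓡 4) q).map_target hy

lemma continuousOn_coordOrient (q : M) :
    ContinuousOn (g.coordOrient q) (extChartAt (𝓡 4) q).target := by
  have h : ContinuousOn (fun x : M ↦ coordVec q x (g.orient x)) (extChartAt (𝓡 4) q).source := by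
    set e := trivializationAt (EuclideanSpace ℝ (Fin 4)) (TangentSpace (𝓡 4)) q with he
    have hb : (extChartAt (𝓡 4) q).source ⊆ e.baseSet := by simp [he]
    have h1 : ContinuousOn (fun x : M ↦ (e ⟨x, g.orient x⟩).2) (extChartAt (𝓡 4) q).source := by
      refine continuous_snd.comp_continuousOn (e.continuousOn.comp
        g.orient_continuous.continuousOn fun x hx ↦ ?_)
      exact e.mem_source.2 (hb hx)
    refine h1.congr fun x hx ↦ ?_
    exact congrFun (e.coe_linearMapAt_of_mem (R := ℝ) (hb hx)) (g.orient x)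
  exact h.comp (continuousOn_extChartAt_symm q) fun y hy ↦ (extChartAt (𝓡 4) q).map_target hy

lemma futureTimelike_iff_coord {q x : M} (hx : x ∈ (extChartAt (𝓡 4) q).source)
    (v : TangentSpace (𝓡 4) x) : g.FutureTimelike x v ↔
      g.coordForm q (extChartAt (𝓡 4) q x) (coordVec q x v) (coordVec q x v) < 0 ∧
      g.coordForm q (extChartAt (𝓡 4) q x) (coordVec q x v)
        (g.coordOrient q (extChartAt (𝓡 4) q x)) < 0 := by
  rw [FutureTimelike, form_eq_coordForm g hx, form_eq_coordForm g hx, orient_eq_coordOrient g hx]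

variable {g} in
lemma hasDerivWithinAt_coord {γ : ℝ → M} {a b t : ℝ} {q : M}
    (hγ : ContMDiffOn 𝓘(ℝ, ℝ) (𝓡 4) 1 γ (Icc a b))
    (hq : MapsTo γ (Icc a b) (extChartAt (𝓡 4) q).source) (ht : t ∈ Icc a b) :
    HasDerivWithinAt (fun t ↦ extChartAt (𝓡 4) q (γ t))
      (coordVec q (γ t) (mfderivWithin 𝓘(ℝ, ℝ) (𝓡 4) γ (Icc a b) t (1 : ℝ))) (Icc a b) t := by
  have hs : γ t ∈ (chartAt (EuclideanSpace ℝ (Fin 4)) q).source := by simpa using hq ht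
  have h1 := (mdifferentiableAt_extChartAt (I := 𝓡 4) hs).hasMFDerivAt
  have h2 := ((hγ t ht).mdifferentiableWithinAt (by norm_num)).hasMFDerivWithinAt
  have h3 : HasFDerivWithinAt (fun t ↦ extChartAt (𝓡 4) q (γ t))
    (_ : ℝ →L[ℝ] EuclideanSpace ℝ (Fin 4)) (Icc a b) t :=
    (h1.comp_hasMFDerivWithinAt t h2).hasFDerivWithinAt
  refine h3.hasDerivWithinAt.congr_deriv ?_
  rw [coordVec, TangentBundle.continuousLinearMapAt_trivializationAt hs]
  rfl

lemma contDiffOn_coord {γ : ℝ → M} {a b : ℝ} {q : M}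
    (hγ : ContMDiffOn 𝓘(ℝ, ℝ) (𝓡 4) 1 γ (Icc a b))
    (hq : MapsTo γ (Icc a b) (extChartAt (𝓡 4) q).source) :
    ContDiffOn ℝ 1 (fun t ↦ extChartAt (𝓡 4) q (γ t)) (Icc a b) := by
  rw [← contMDiffOn_iff_contDiffOn]
  refine (contMDiffOn_extChartAt (n := 1)).comp hγ fun t ht ↦ by simpa using hq ht

/-- A `C¹` curve of the model space whose velocities are timelike for the metric in the chart at `q`
is a timelike curve. -/
lemma chronIn_of_coord_curve {q : M} {U : Set M} {c : ℝ → EuclideanSpace ℝ (Fin 4)} {a b : ℝ}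
    (hab : a < b) (hc : ContDiffOn ℝ 1 c (Icc a b))
    (hct : MapsTo c (Icc a b) (extChartAt (𝓡 4) q).target)
    (hU : ∀ t ∈ Icc a b, (extChartAt (𝓡 4) q).symm (c t) ∈ U)
    (h : ∀ t ∈ Icc a b, ∀ v, HasDerivWithinAt c v (Icc a b) t →
      g.coordForm q (c t) v v < 0 ∧ g.coordForm q (c t) v (g.coordOrient q (c t)) < 0) :
    g.ChronIn U ((extChartAt (𝓡 4) q).symm (c a)) ((extChartAt (𝓡 4) q).symm (c b)) := by
  set φ := extChartAt (𝓡 4) q with hφ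
  have h1 : ContMDiffOn 𝓘(ℝ, ℝ) (𝓡 4) 1 (fun t ↦ φ.symm (c t)) (Icc a b) :=
    (contMDiffOn_extChartAt_symm q).comp hc.contMDiffOn hct
  have h2 : MapsTo (fun t ↦ φ.symm (c t)) (Icc a b) φ.source := fun t ht ↦ φ.map_target (hct ht)
  refine ⟨fun t ↦ φ.symm (c t), a, b, hab,
    IsC1Piece.isPiecewiseC1Curve hab ⟨h1, fun t ht ↦ ?_⟩, hU, rfl, rfl⟩
  rw [futureTimelike_iff_coord g (h2 ht), ← hφ, φ.right_inv (hct ht)]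
  exact h t ht _ ((hasDerivWithinAt_coord h1 h2 ht).congr
    (fun u hu ↦ (φ.right_inv (hct hu)).symm) (φ.right_inv (hct ht)).symm)

end SpacetimeMetric

namespace SpacetimeMetric

variable {M : Type*} [TopologicalSpace M] [ChartedSpace (EuclideanSpace ℝ (Fin 4)) M]
  [IsManifold (𝓡 4) ∞ M] (g : SpacetimeMetric M)

/-! ### Openness of the chronology relation -/

lemma continuousAt_coordForm (q : M) :
    ContinuousAt (g.coordForm q) (extChartAt (𝓡 4) q q) :=
  (g.contDiffOn_coordForm q).continuousOn.continuousAt (extChartAt_target_mem_nhds q)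

lemma continuousAt_coordOrient (q : M) :
    ContinuousAt (g.coordOrient q) (extChartAt (𝓡 4) q q) :=
  (g.continuousOn_coordOrient q).continuousAt (extChartAt_target_mem_nhds q)

/-- In the chart at `q`, short segments whose direction is close to a timelike direction at `q` are
timelike curves. -/
lemma exists_chronIn_of_segment {q : M} {U : Set M} (hU : U ∈ 𝓝 q)
    {v₀ : EuclideanSpace ℝ (Fin 4)}
    (h₁ : g.coordForm q (extChartAt (𝓡 4) q q) v₀ v₀ < 0)
    (h₂ : g.coordForm q (extChartAt (𝓡 4) q q) v₀
      (g.coordOrient q (extChartAt (𝓡 4) q q)) < 0) :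
    ∃ ρ > 0, ∀ x ∈ Metric.ball (extChartAt (𝓡 4) q q) ρ,
      ∀ y ∈ Metric.ball (extChartAt (𝓡 4) q q) ρ, ∀ τ > (0 : ℝ),
      τ⁻¹ • (y - x) ∈ Metric.ball v₀ ρ →
      g.ChronIn U ((extChartAt (𝓡 4) q).symm x) ((extChartAt (𝓡 4) q).symm y) := by
  have cG := g.continuousAt_coordForm q
  have cT := g.continuousAt_coordOrient q
  have c1 : ContinuousAt (fun z : EuclideanSpace ℝ (Fin 4) × EuclideanSpace ℝ (Fin 4) ↦
      g.coordForm q z.1 z.2 z.2) (extChartAt (𝓡 4) q q, v₀) := by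
    have := cG.comp (x := (extChartAt (𝓡 4) q q, v₀)) continuousAt_fst
    exact (this.clm_apply continuousAt_snd).clm_apply continuousAt_snd
  have c2 : ContinuousAt (fun z : EuclideanSpace ℝ (Fin 4) × EuclideanSpace ℝ (Fin 4) ↦
      g.coordForm q z.1 z.2 (g.coordOrient q z.1)) (extChartAt (𝓡 4) q q, v₀) := by
    have := cG.comp (x := (extChartAt (𝓡 4) q q, v₀)) continuousAt_fst
    have h' := cT.comp (x := (extChartAt (𝓡 4) q q, v₀)) continuousAt_fst
    exact (this.clm_apply continuousAt_snd).clm_apply h'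
  have e3 : ∀ᶠ y in 𝓝 (extChartAt (𝓡 4) q q), y ∈ (extChartAt (𝓡 4) q).target ∧
      (extChartAt (𝓡 4) q).symm y ∈ U := by
    have h := (continuousAt_extChartAt_symm (I := 𝓡 4) q).eventually (p := (· ∈ U))
    rw [extChartAt_to_inv] at h
    exact Filter.Eventually.and (extChartAt_target_mem_nhds (I := 𝓡 4) q) (h hU)
  have ev := ((c1.eventually (gt_mem_nhds h₁)).and (c2.eventually (gt_mem_nhds h₂))).and
    ((continuousAt_fst (p := (extChartAt (𝓡 4) q q, v₀))).eventually e3)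
  obtain ⟨ρ, hρ, hb⟩ := Metric.eventually_nhds_iff_ball.1 ev
  refine ⟨ρ, hρ, fun x hx y hy τ hτ hu ↦ ?_⟩
  set u := τ⁻¹ • (y - x) with hudef
  have hyu : x + τ • u = y := by
    rw [hudef, smul_inv_smul₀ hτ.ne']; abel
  have hc : ∀ t ∈ Icc 0 τ, x + t • u ∈ Metric.ball (extChartAt (𝓡 4) q q) ρ := by
    intro t ht
    have := (convex_ball (extChartAt (𝓡 4) q q) ρ).add_smul_sub_mem hx hy
      (t := t / τ) ⟨div_nonneg ht.1 hτ.le, (div_le_one hτ).2 ht.2⟩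
    rwa [div_eq_mul_inv, mul_smul] at this
  have hz : ∀ t ∈ Icc 0 τ, (x + t • u, u) ∈ Metric.ball (extChartAt (𝓡 4) q q, v₀) ρ := by
    intro t ht
    rw [← ball_prod_same]
    exact ⟨hc t ht, hu⟩
  have key := g.chronIn_of_coord_curve (q := q) (U := U) (c := fun t ↦ x + t • u) hτ
    (by fun_prop) (fun t ht ↦ (hb _ (hz t ht)).2.1) (fun t ht ↦ (hb _ (hz t ht)).2.2)
    (fun t ht v hv ↦ ?_)
  · simpa [hyu] using key
  · have hd : HasDerivWithinAt (fun t : ℝ ↦ x + t • u) u (Icc 0 τ) t := by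
      simpa using (((hasDerivAt_id t).smul_const u).const_add x).hasDerivWithinAt
    rw [(uniqueDiffOn_Icc hτ t ht).eq_deriv _ hv hd]
    exact (hb _ (hz t ht)).1

lemma coordForm_coordOrient_neg (q : M) :
    g.coordForm q (extChartAt (𝓡 4) q q) (g.coordOrient q (extChartAt (𝓡 4) q q))
      (g.coordOrient q (extChartAt (𝓡 4) q q)) < 0 := by
  have hq := mem_extChartAt_source (I := 𝓡 4) q
  rw [← orient_eq_coordOrient g hq, ← form_eq_coordForm g hq]
  exact g.orient_timelike q

lemma exists_chronIn_past_future {q : M} {U : Set M} (hU : U ∈ 𝓝 q) :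
    ∃ x ∈ U, ∃ y ∈ U, x ≠ q ∧ y ≠ q ∧ g.ChronIn U x q ∧ g.ChronIn U q y := by
  set φ := extChartAt (𝓡 4) q with hφ
  set v₀ := g.coordOrient q (φ q) with hv₀
  have hneg := g.coordForm_coordOrient_neg q
  obtain ⟨ρ, hρ, H⟩ := g.exists_chronIn_of_segment hU hneg hneg
  have hv0 : v₀ ≠ 0 := by
    intro h0
    rw [← hφ, ← hv₀, h0] at hneg
    simp at hneg
  have hlim : ∀ k : ℝ, ∀ᶠ τ : ℝ in 𝓝[>] 0, φ q + (k * τ) • v₀ ∈ Metric.ball (φ q) ρ ∧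
      φ q + (k * τ) • v₀ ∈ φ.target := by
    intro k
    have hc : ContinuousAt (fun τ : ℝ ↦ φ q + (k * τ) • v₀) 0 := by fun_prop
    have := hc.tendsto
    simp only [mul_zero, zero_smul, add_zero] at this
    exact ((this.eventually (Metric.ball_mem_nhds _ hρ)).and
      (this.eventually (extChartAt_target_mem_nhds q))).filter_mono nhdsWithin_le_nhds
  obtain ⟨τ, ⟨⟨h1, h1'⟩, h2, h2'⟩, hτ⟩ :=
    (((hlim 1).and (hlim (-1))).and self_mem_nhdsWithin).exists
  have hτ' : (0 : ℝ) < τ := hτ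
  have hqs : φ.symm (φ q) = q := φ.left_inv (mem_extChartAt_source q)
  have hball := Metric.mem_ball_self (x := φ q) hρ
  have e1 := H _ hball _ h1 τ hτ (by
    rw [add_sub_cancel_left, one_mul, inv_smul_smul₀ hτ'.ne']
    exact Metric.mem_ball_self hρ)
  have e2 := H _ h2 _ hball τ hτ (by
    rw [sub_add_cancel_left, ← neg_smul, neg_mul, one_mul, neg_neg, inv_smul_smul₀ hτ'.ne']
    exact Metric.mem_ball_self hρ)
  rw [← hφ, hqs] at e1 e2
  have hne : ∀ k : ℝ, k ≠ 0 → φ q + (k * τ) • v₀ ∈ φ.target → φ.symm (φ q + (k * τ) • v₀) ≠ q := by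
    intro k hk ht he
    have := congrArg φ he
    rw [φ.right_inv ht, add_eq_left, smul_eq_zero] at this
    rcases this with h | h
    · exact mul_ne_zero hk hτ'.ne' h
    · exact hv0 h
  refine ⟨_, ?_, _, ?_, hne (-1) (by norm_num) h2', hne 1 one_ne_zero h1', e2, e1⟩
  · obtain ⟨γ, a, b, hab, -, hm, ha, hb⟩ := e2
    exact ha ▸ hm (left_mem_Icc.2 hab.le)
  · obtain ⟨γ, a, b, hab, -, hm, ha, hb⟩ := e1
    exact hb ▸ hm (right_mem_Icc.2 hab.le)

variable {g}

lemma exists_mapsTo_Icc_left {X : Type*} [TopologicalSpace X] {γ : ℝ → X} {s b : ℝ} (hsb : s < b)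
    (hγ : ContinuousOn γ (Icc s b)) {V : Set X} (hV : V ∈ 𝓝 (γ b)) :
    ∃ s' ∈ Ico s b, MapsTo γ (Icc s' b) V := by
  have h : ∀ᶠ t in 𝓝[Icc s b] b, γ t ∈ V := hγ b (right_mem_Icc.2 hsb.le) hV
  rw [nhdsWithin_Icc_eq_nhdsLE hsb] at h
  obtain ⟨l, hl, hsub⟩ := mem_nhdsLE_iff_exists_Icc_subset.1 h
  exact ⟨max s l, ⟨le_max_left _ _, max_lt hsb hl⟩,
    fun t ht ↦ hsub ⟨(le_max_right _ _).trans ht.1, ht.2⟩⟩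

lemma exists_mapsTo_Icc_right {X : Type*} [TopologicalSpace X] {γ : ℝ → X} {a s : ℝ} (has : a < s)
    (hγ : ContinuousOn γ (Icc a s)) {V : Set X} (hV : V ∈ 𝓝 (γ a)) :
    ∃ s' ∈ Ioc a s, MapsTo γ (Icc a s') V := by
  have h : ∀ᶠ t in 𝓝[Icc a s] a, γ t ∈ V := hγ a (left_mem_Icc.2 has.le) hV
  rw [nhdsWithin_Icc_eq_nhdsGE has] at h
  obtain ⟨l, hl, hsub⟩ := mem_nhdsGE_iff_exists_Icc_subset.1 h
  exact ⟨min s l, ⟨lt_min has hl, min_le_left _ _⟩,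
    fun t ht ↦ hsub ⟨ht.1, ht.2.trans (min_le_right _ _)⟩⟩

lemma ChronIn.eventually_right {p q : M} {U : Set M} (hU : IsOpen U) (h : g.ChronIn U p q) :
    ∀ᶠ y in 𝓝 q, g.ChronIn U p y := by
  obtain ⟨γ, a, b, hab, hγ, hm, rfl, rfl⟩ := h
  obtain ⟨s₀, hs₀, hp₀⟩ := (hγ.2.2 a (left_mem_Icc.2 hab.le) b (right_mem_Icc.2 hab.le) hab).2
  set φ := extChartAt (𝓡 4) (γ b) with hφ
  obtain ⟨s, hs, hsrc⟩ := exists_mapsTo_Icc_left hs₀.2 hp₀.1.continuousOn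
    (extChartAt_source_mem_nhds (I := 𝓡 4) (γ b))
  have hp := hp₀.mono hs.2 hs.1 le_rfl
  have hsb : b ∈ Icc s b := right_mem_Icc.2 hs.2.le
  have hd := hasDerivWithinAt_coord hp.1 hsrc hsb
  obtain ⟨h1, h2⟩ := (futureTimelike_iff_coord g (hsrc hsb) _).1 (hp.2 b hsb)
  set v₀ := coordVec (γ b) (γ b) (mfderivWithin 𝓘(ℝ, ℝ) (𝓡 4) γ (Icc s b) b (1 : ℝ))
  obtain ⟨ρ, hρ, H⟩ := g.exists_chronIn_of_segment
    (hU.mem_nhds (hm (right_mem_Icc.2 hab.le))) h1 h2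
  have hsl := (hasDerivWithinAt_iff_tendsto_slope' (by simp)).1
    (hd.mono (Ioo_subset_Icc_self (a := s) (b := b)))
  have hne : (𝓝[Ioo s b] b).NeBot := by
    rw [nhdsWithin_Ioo_eq_nhdsLT hs.2]; infer_instance
  obtain ⟨t, ⟨ht1, ht2⟩, ht⟩ := ((hsl.eventually (Metric.ball_mem_nhds v₀ hρ)).and
    ((hd.continuousWithinAt.mono Ioo_subset_Icc_self).eventually
      (Metric.ball_mem_nhds _ hρ))).and self_mem_nhdsWithin |>.exists
  have hat : a < t := hs₀.1.trans_lt (hs.1.trans_lt ht.1)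
  have htb : 0 < b - t := sub_pos.2 ht.2
  have hcont := continuousAt_extChartAt (I := 𝓡 4) (γ b)
  have hv : Filter.Tendsto (fun y ↦ (b - t)⁻¹ • (φ y - φ (γ t))) (𝓝 (γ b))
      (𝓝 ((b - t)⁻¹ • (φ (γ b) - φ (γ t)))) := (hcont.sub_const _).const_smul _
  have hslope : (b - t)⁻¹ • (φ (γ b) - φ (γ t)) ∈ Metric.ball v₀ ρ := by
    rw [slope_comm] at ht1
    exact ht1
  filter_upwards [hv.eventually (Metric.isOpen_ball.mem_nhds hslope),
    hcont.eventually (Metric.ball_mem_nhds _ hρ), extChartAt_source_mem_nhds (I := 𝓡 4) (γ b)]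
    with y hy1 hy2 hy3
  have h3 := H _ ht2 _ hy2 _ htb hy1
  rw [← hφ, φ.left_inv (hsrc ⟨ht.1.le, ht.2.le⟩), φ.left_inv hy3] at h3
  refine ChronIn.trans ⟨γ, a, t, hat, ?_, ?_, rfl, rfl⟩ h3
  · exact hγ.mono (Icc_subset_Icc_right ht.2.le) ordConnected_Icc (nontrivial_Icc hat)
  · exact hm.mono_left (Icc_subset_Icc_right ht.2.le)

lemma ChronIn.eventually_left {p q : M} {U : Set M} (hU : IsOpen U) (h : g.ChronIn U p q) :
    ∀ᶠ x in 𝓝 p, g.ChronIn U x q := by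
  obtain ⟨γ, a, b, hab, hγ, hm, rfl, rfl⟩ := h
  obtain ⟨s₀, hs₀, hp₀⟩ := (hγ.2.2 a (left_mem_Icc.2 hab.le) b (right_mem_Icc.2 hab.le) hab).1
  set φ := extChartAt (𝓡 4) (γ a) with hφ
  obtain ⟨s, hs, hsrc⟩ := exists_mapsTo_Icc_right hs₀.1 hp₀.1.continuousOn
    (extChartAt_source_mem_nhds (I := 𝓡 4) (γ a))
  have hp := hp₀.mono hs.1 le_rfl hs.2
  have hsa : a ∈ Icc a s := left_mem_Icc.2 hs.1.le
  have hd := hasDerivWithinAt_coord hp.1 hsrc hsa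
  obtain ⟨h1, h2⟩ := (futureTimelike_iff_coord g (hsrc hsa) _).1 (hp.2 a hsa)
  set v₀ := coordVec (γ a) (γ a) (mfderivWithin 𝓘(ℝ, ℝ) (𝓡 4) γ (Icc a s) a (1 : ℝ))
  obtain ⟨ρ, hρ, H⟩ := g.exists_chronIn_of_segment
    (hU.mem_nhds (hm (left_mem_Icc.2 hab.le))) h1 h2
  have hsl := (hasDerivWithinAt_iff_tendsto_slope' (by simp)).1
    (hd.mono (Ioo_subset_Icc_self (a := a) (b := s)))
  have hne : (𝓝[Ioo a s] a).NeBot := by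
    rw [nhdsWithin_Ioo_eq_nhdsGT hs.1]; infer_instance
  obtain ⟨t, ⟨ht1, ht2⟩, ht⟩ := ((hsl.eventually (Metric.ball_mem_nhds v₀ hρ)).and
    ((hd.continuousWithinAt.mono Ioo_subset_Icc_self).eventually
      (Metric.ball_mem_nhds _ hρ))).and self_mem_nhdsWithin |>.exists
  have htb : t < b := ht.2.trans_le (hs.2.trans hs₀.2)
  have hat : 0 < t - a := sub_pos.2 ht.1
  have hcont := continuousAt_extChartAt (I := 𝓡 4) (γ a)
  have hv : Filter.Tendsto (fun x ↦ (t - a)⁻¹ • (φ (γ t) - φ x)) (𝓝 (γ a))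
      (𝓝 ((t - a)⁻¹ • (φ (γ t) - φ (γ a)))) := (hcont.const_sub _).const_smul _
  filter_upwards [hv.eventually (Metric.isOpen_ball.mem_nhds ht1),
    hcont.eventually (Metric.ball_mem_nhds _ hρ), extChartAt_source_mem_nhds (I := 𝓡 4) (γ a)]
    with x hx1 hx2 hx3
  have h3 := H _ hx2 _ ht2 _ hat hx1
  rw [← hφ, φ.left_inv (hsrc ⟨ht.1.le, ht.2.le⟩), φ.left_inv hx3] at h3
  refine ChronIn.trans h3 ⟨γ, t, b, htb, ?_, ?_, rfl, rfl⟩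
  · exact hγ.mono (Icc_subset_Icc_left ht.1.le) ordConnected_Icc (nontrivial_Icc htb)
  · exact hm.mono_left (Icc_subset_Icc_left ht.1.le)

end SpacetimeMetric

namespace SpacetimeMetric

variable {M : Type*} [TopologicalSpace M] [ChartedSpace (EuclideanSpace ℝ (Fin 4)) M]
  [IsManifold (𝓡 4) ∞ M] {g : SpacetimeMetric M}

/-! ### Deforming causal curves -/

/-- The effect of moving a causal vector `v` to a nearby base point, where the form is `B` instead
of `A`, and tilting it by `s • T`: it becomes timelike if the tilt outweighs the change of the
form. -/
lemma form_add_smul_neg {E : Type*} [NormedAddCommGroup E] [NormedSpace ℝ E]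
    {A B : E →L[ℝ] E →L[ℝ] ℝ} {v T : E} {s κ L R : ℝ} (hs : 0 < s) (hA : A v v ≤ 0)
    (hAB : ‖B - A‖ ≤ L) (hv : ‖v‖ ≤ R) (h₁ : B v T < -κ) (h₂ : B T v < -κ) (hT : B T T < 0)
    (hL : L * R ^ 2 ≤ 2 * κ * s) : B (v + s • T) (v + s • T) < 0 := by
  have e : B (v + s • T) (v + s • T) = A v v + (B - A) v v + s * B v T + s * B T v
      + s ^ 2 * B T T := by
    simp only [map_add, map_smul, add_apply, smul_apply, sub_apply, smul_eq_mul]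
    ring
  have h3 : (B - A) v v ≤ L * R ^ 2 := by
    refine (le_abs_self _).trans (((B - A).le_opNorm₂ v v).trans ?_)
    have := norm_nonneg v
    have hL0 : 0 ≤ L := (norm_nonneg (B - A)).trans hAB
    calc ‖B - A‖ * ‖v‖ * ‖v‖ = ‖B - A‖ * ‖v‖ ^ 2 := by ring
      _ ≤ L * R ^ 2 := by gcongr
  rw [e]
  have h4 : s * B v T < s * -κ := mul_lt_mul_of_pos_left h₁ hs
  have h5 : s * B T v < s * -κ := mul_lt_mul_of_pos_left h₂ hs
  have h6 : s ^ 2 * B T T < 0 := mul_neg_of_pos_of_neg (by positivity) hT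
  linarith

/-- The end point of a short causal curve lies in the chronological future of points arbitrarily
close to its starting point: push the curve backwards in time, in a chart, by the multiple
`ε (exp (k (b - t)) - 1)` of a timelike vector. The displacement vanishes at the end `b`, and for
large `k` its derivative tilts the velocity into the timelike cone by more than the change of the
(locally Lipschitz) metric can undo. -/
lemma exists_chron_of_isC1Piece {γ : ℝ → M} {a b : ℝ} (hab : a < b)
    (h : IsC1Piece g.FutureCausal γ a b) :
    ∃ s ∈ Ico a b, ∀ W ∈ 𝓝 (γ s), ∃ x ∈ W, g.Chron x (γ b) := by
  set φ := extChartAt (𝓡 4) (γ b) with hφ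
  set y₀ := φ (γ b) with hy₀
  set G := g.coordForm (γ b) with hG
  set T := g.coordOrient (γ b) with hT
  obtain ⟨s₀, hs₀, hsrc₀⟩ := exists_mapsTo_Icc_left hab h.1.continuousOn
    (extChartAt_source_mem_nhds (I := 𝓡 4) (γ b))
  have hp₀ := h.mono hs₀.2 hs₀.1 le_rfl
  set c : ℝ → EuclideanSpace ℝ (Fin 4) := fun t ↦ φ (γ t) with hc
  have hc1 : ContDiffOn ℝ 1 c (Icc s₀ b) := contDiffOn_coord hp₀.1 hsrc₀
  have hub := uniqueDiffOn_Icc hs₀.2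
  set c' : ℝ → EuclideanSpace ℝ (Fin 4) := derivWithin c (Icc s₀ b) with hc'
  have hcd : ∀ t ∈ Icc s₀ b, HasDerivWithinAt c (c' t) (Icc s₀ b) t := fun t ht ↦
    ((hc1.differentiableOn one_ne_zero) t ht).hasDerivWithinAt
  have hc'c : ContinuousOn c' (Icc s₀ b) := hc1.continuousOn_derivWithin hub le_rfl
  have hcau : ∀ t ∈ Icc s₀ b, G (c t) (c' t) (c' t) ≤ 0 ∧ G (c t) (c' t) (T (c t)) < 0 ∧
      G (c t) (T (c t)) (c' t) < 0 := by
    intro t ht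
    have e := (hub t ht).eq_deriv _ (hcd t ht) (hasDerivWithinAt_coord hp₀.1 hsrc₀ ht)
    obtain ⟨-, h1, h2⟩ := hp₀.2 t ht
    have h3 := h2
    rw [g.symm] at h3
    rw [form_eq_coordForm g (hsrc₀ ht)] at h1 h2 h3
    rw [orient_eq_coordOrient g (hsrc₀ ht)] at h2 h3
    rw [e]
    exact ⟨h1, h2, h3⟩
  have hbI : b ∈ Icc s₀ b := right_mem_Icc.2 hs₀.2.le
  set v₀ := c' b with hv₀
  set T₀ := T y₀ with hT₀
  obtain ⟨-, hvT, hTv⟩ := hcau b hbI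
  obtain ⟨κ, hκ, hκ1, hκ2⟩ : ∃ κ : ℝ, 0 < κ ∧ G y₀ v₀ T₀ < -κ ∧ G y₀ T₀ v₀ < -κ := by
    obtain ⟨κ, h1, h2⟩ := exists_between (max_lt hvT hTv)
    exact ⟨-κ, neg_pos.2 h2, by rw [neg_neg]; exact (le_max_left _ _).trans_lt h1,
      by rw [neg_neg]; exact (le_max_right _ _).trans_lt h1⟩
  have hTT : G y₀ T₀ T₀ < 0 := g.coordForm_coordOrient_neg (γ b)
  have hGat : ContDiffAt ℝ 1 G y₀ :=
    (g.contDiffOn_coordForm (γ b)).contDiffAt (extChartAt_target_mem_nhds _)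
  obtain ⟨K, O, hO, hLip⟩ := hGat.exists_lipschitzOnWith
  have cG : ContinuousAt (fun z : EuclideanSpace ℝ (Fin 4) × EuclideanSpace ℝ (Fin 4) ↦ G z.1)
      (y₀, v₀) := ContinuousAt.comp (f := Prod.fst) (x := (y₀, v₀))
      (g.continuousAt_coordForm (γ b)) continuousAt_fst
  have cT : ContinuousAt (fun z : EuclideanSpace ℝ (Fin 4) × EuclideanSpace ℝ (Fin 4) ↦ T z.1)
      (y₀, v₀) := ContinuousAt.comp (f := Prod.fst) (x := (y₀, v₀))
      (g.continuousAt_coordOrient (γ b)) continuousAt_fst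
  have hfst : ContinuousAt Prod.fst (y₀, v₀) := continuousAt_fst
  have ev := ((((((cG.clm_apply continuousAt_snd).clm_apply
      (continuousAt_const (y := T₀))).eventually (gt_mem_nhds hκ1)).and
    (((cG.clm_apply (continuousAt_const (y := T₀))).clm_apply
      continuousAt_snd).eventually (gt_mem_nhds hκ2))).and
    (((cG.clm_apply (continuousAt_const (y := T₀))).clm_apply
      (continuousAt_const (y := T₀))).eventually (gt_mem_nhds hTT))).and
    (((cG.clm_apply continuousAt_snd).clm_apply cT).eventually (gt_mem_nhds hvT))).and
    (hfst.eventually (Filter.inter_mem hO (extChartAt_target_mem_nhds (I := 𝓡 4) (γ b))))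
  obtain ⟨ρ, hρ, H⟩ := Metric.eventually_nhds_iff_ball.1 ev
  -- Shorten the curve so that it stays, with its velocity, in the half-size ball.
  obtain ⟨s₁, hs₁, hm₁⟩ := exists_mapsTo_Icc_left hs₀.2 (hc1.continuousOn.prodMk hc'c)
    (Metric.ball_mem_nhds (c b, c' b) (half_pos hρ))
  have hIcc : Icc s₁ b ⊆ Icc s₀ b := Icc_subset_Icc_left hs₁.1
  refine ⟨s₁, ⟨hs₀.1.trans hs₁.1, hs₁.2⟩, fun W hW ↦ ?_⟩
  set R := ‖v₀‖ + ρ with hR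
  -- The rate at which the tilt `f'` outweighs the change of the form, of order `K * |f|`.
  set k := K * ‖T₀‖ * R ^ 2 / (2 * κ) + 1 with hk
  have hk0 : 0 < k := by positivity
  set m := Real.exp (k * (b - s₁)) with hm
  have hm0 : 0 < m := Real.exp_pos _
  -- For small `ε` the new starting point is in `W`, and the deformation is small in `C¹`.
  have hev : ∀ᶠ ε : ℝ in 𝓝[>] 0, φ.symm (c s₁ + (-ε * (m - 1)) • T₀) ∈ W ∧
      ε * (m * (k + 1) * ‖T₀‖) < ρ / 2 := by
    have hs₁I : s₁ ∈ Icc s₀ b := ⟨hs₁.1, hs₁.2.le⟩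
    have hsrc : c s₁ ∈ φ.target := φ.map_source (hsrc₀ hs₁I)
    have h1 : ContinuousAt (fun ε : ℝ ↦ c s₁ + (-ε * (m - 1)) • T₀) 0 := by fun_prop
    have h2 : ContinuousAt φ.symm (c s₁ + (-0 * (m - 1)) • T₀) := by
      rw [neg_zero, zero_mul, zero_smul, add_zero]
      exact continuousAt_extChartAt_symm'' hsrc
    have h3 := ContinuousAt.comp (x := (0 : ℝ)) h2 h1
    have h4 : W ∈ 𝓝 ((φ.symm ∘ fun ε : ℝ ↦ c s₁ + (-ε * (m - 1)) • T₀) 0) := by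
      simpa [hc, φ.left_inv (hsrc₀ hs₁I)] using hW
    have h5 : ContinuousAt (fun ε : ℝ ↦ ε * (m * (k + 1) * ‖T₀‖)) 0 := by fun_prop
    have h6 : ∀ᶠ ε : ℝ in 𝓝 0, ε * (m * (k + 1) * ‖T₀‖) < ρ / 2 :=
      h5.eventually (gt_mem_nhds (by simpa using hρ))
    exact ((h3.eventually h4).and h6).filter_mono nhdsWithin_le_nhds
  obtain ⟨ε, ⟨hεW, hε1⟩, hε⟩ := (hev.and self_mem_nhdsWithin).exists
  have hε0 : (0 : ℝ) < ε := hε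
  refine ⟨_, hεW, ?_⟩
  set f : ℝ → ℝ := fun t ↦ -ε * (Real.exp (k * (b - t)) - 1) with hf
  set f' : ℝ → ℝ := fun t ↦ ε * (k * Real.exp (k * (b - t))) with hf'
  have hfd : ∀ t, HasDerivAt f (f' t) t := by
    intro t
    have h1 : HasDerivAt (fun t ↦ k * (b - t)) (k * (-1)) t :=
      ((hasDerivAt_id t).const_sub b).const_mul k
    refine ((h1.exp.sub_const 1).const_mul (-ε)).congr_deriv ?_
    simp only [hf']
    ring
  have hf'0 : ∀ t, 0 < f' t := fun t ↦ by positivity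
  have hfb : ∀ t ∈ Icc s₁ b, |f t| * k ≤ f' t ∧ |f t| * ‖T₀‖ < ρ / 2 ∧ f' t * ‖T₀‖ < ρ / 2 := by
    intro t ht
    have h1 : 1 ≤ Real.exp (k * (b - t)) :=
      Real.one_le_exp (mul_nonneg hk0.le (sub_nonneg.2 ht.2))
    have h2 : Real.exp (k * (b - t)) ≤ m :=
      Real.exp_le_exp.2 (mul_le_mul_of_nonneg_left (by linarith [ht.1]) hk0.le)
    set e := Real.exp (k * (b - t)) with he
    have h3 : |f t| = ε * (e - 1) := by
      simp only [hf]
      rw [neg_mul, abs_neg, abs_of_nonneg (mul_nonneg hε0.le (by linarith))]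
    have h4 : |f t| * k ≤ f' t := by
      rw [h3]
      have : f' t = ε * (e - 1) * k + ε * k := by simp only [hf']; ring
      rw [this]
      have := mul_pos hε0 hk0
      linarith
    have h5 : |f t| ≤ ε * (m * (k + 1)) := by
      rw [h3]
      refine mul_le_mul_of_nonneg_left ?_ hε0.le
      have := mul_pos hm0 hk0
      linarith
    have h6 : f' t ≤ ε * (m * (k + 1)) := by
      refine mul_le_mul_of_nonneg_left ?_ hε0.le
      have := mul_le_mul_of_nonneg_left h2 hk0.le
      linarith
    have h7 : ε * (m * (k + 1)) * ‖T₀‖ < ρ / 2 := by linarith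
    exact ⟨h4, (mul_le_mul_of_nonneg_right h5 (norm_nonneg _)).trans_lt h7,
      (mul_le_mul_of_nonneg_right h6 (norm_nonneg _)).trans_lt h7⟩
  have hin : ∀ t ∈ Icc s₁ b, (c t, c' t) ∈ Metric.ball (y₀, v₀) ρ ∧
      (c t + f t • T₀, c' t) ∈ Metric.ball (y₀, v₀) ρ ∧
      (c t + f t • T₀, c' t + f' t • T₀) ∈ Metric.ball (y₀, v₀) ρ := by
    intro t ht
    have h1 := hm₁ ht
    obtain ⟨-, h2, h3⟩ := hfb t ht
    simp only [← ball_prod_same, mem_prod, mem_ball_iff_norm] at h1 ⊢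
    have h4 : ‖f t • T₀‖ < ρ / 2 := by rwa [norm_smul, Real.norm_eq_abs]
    have h5 : ‖f' t • T₀‖ < ρ / 2 := by
      rwa [norm_smul, Real.norm_eq_abs, abs_of_pos (hf'0 t)]
    have h6 : ‖c t - y₀‖ < ρ / 2 := h1.1
    have h7 : ‖c' t - v₀‖ < ρ / 2 := h1.2
    have h8 : ‖c t + f t • T₀ - y₀‖ < ρ := by
      rw [add_sub_right_comm]
      exact (norm_add_le _ _).trans_lt (by linarith)
    have h9 : ‖c' t + f' t • T₀ - v₀‖ < ρ := by
      rw [add_sub_right_comm]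
      exact (norm_add_le _ _).trans_lt (by linarith)
    exact ⟨⟨by linarith, by linarith⟩, ⟨h8, by linarith⟩, h8, h9⟩
  have key := g.chronIn_of_coord_curve (q := γ b) (U := univ) (c := fun t ↦ c t + f t • T₀) hs₁.2
    ((hc1.mono hIcc).add (ContDiff.contDiffOn (by simp only [hf]; fun_prop)))
    (fun t ht ↦ (H _ (hin t ht).2.1).2.2) (fun _ _ ↦ mem_univ _) (fun t ht v hv ↦ ?_)
  · have e1 : c b + f b • T₀ = φ (γ b) := by simp [hf, hc]
    have e2 : f s₁ = -ε * (m - 1) := rfl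
    simp only [e1, e2] at key
    rwa [← hφ, φ.left_inv (mem_extChartAt_source (γ b))] at key
  · have hd : HasDerivWithinAt (fun t ↦ c t + f t • T₀) (c' t + f' t • T₀) (Icc s₁ b) t :=
      ((hcd t (hIcc ht)).mono hIcc).add (((hfd t).smul_const T₀).hasDerivWithinAt)
    rw [(uniqueDiffOn_Icc hs₁.2 t ht).eq_deriv _ hv hd]
    obtain ⟨i1, i2, i3⟩ := hin t ht
    obtain ⟨⟨⟨⟨a1, a2⟩, a3⟩, -⟩, a5, -⟩ := H _ i2
    refine ⟨form_add_smul_neg (hf'0 t) (hcau t (hIcc ht)).1 (L := K * (|f t| * ‖T₀‖)) (R := R)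
      ?_ ?_ a1 a2 a3 ?_, (H _ i3).1.2⟩
    · have := hLip.norm_sub_le a5 (H _ i1).2.1
      rwa [add_sub_cancel_left, norm_smul, Real.norm_eq_abs] at this
    · have h1 := i1
      rw [← ball_prod_same] at h1
      have h2 : ‖c' t - v₀‖ < ρ := mem_ball_iff_norm.1 h1.2
      have := norm_le_norm_add_norm_sub' (c' t) v₀
      linarith
    · have h1 := (hfb t ht).1
      have h2 : K * ‖T₀‖ * R ^ 2 ≤ 2 * κ * k := by
        rw [hk, mul_add, mul_div_cancel₀ _ (by positivity)]
        linarith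
      calc K * (|f t| * ‖T₀‖) * R ^ 2 = (K * ‖T₀‖ * R ^ 2) * |f t| := by ring
        _ ≤ (2 * κ * k) * |f t| := mul_le_mul_of_nonneg_right h2 (abs_nonneg _)
        _ = 2 * κ * (|f t| * k) := by ring
        _ ≤ 2 * κ * f' t := mul_le_mul_of_nonneg_left h1 (by positivity)

end SpacetimeMetric

namespace SpacetimeMetric

/-! ### Inextendible timelike curves -/

/-- The greedy choice of a chain without limit: if every point `q` of `U` has an `R`-successor of
all points near `q`, take steps at least half as long as possible (lengths being truncated at `1`).
Near a limit point the steps would have to be short, although longer ones are possible there. -/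
lemma exists_seq_without_limit {X : Type*} [TopologicalSpace X]
    [TopologicalSpace.MetrizableSpace X] {R : X → X → Prop} {U : Set X}
    (hR : ∀ q ∈ U, ∃ e ∈ U, e ≠ q ∧ ∀ᶠ x in 𝓝 q, R x e) {p : X} (hp : p ∈ U) :
    ∃ s : ℕ → X, s 0 = p ∧ (∀ n, s n ∈ U) ∧ (∀ n, R (s n) (s (n + 1))) ∧
      ∀ q ∈ U, ¬ Filter.Tendsto s Filter.atTop (𝓝 q) := by
  let := TopologicalSpace.metrizableSpaceMetric X
  have step : ∀ x : U, ∃ y : U, R x y ∧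
      ∀ e ∈ U, R x e → min 1 (dist (x : X) e) ≤ 2 * dist (x : X) y := by
    rintro ⟨x, hx⟩
    set A : Set ℝ := {d | ∃ e ∈ U, R x e ∧ d = min 1 (dist x e)} with hA
    obtain ⟨e, he, hex, hRe⟩ := hR x hx
    have hbdd : BddAbove A := ⟨1, by rintro _ ⟨e, -, -, rfl⟩; exact min_le_left _ _⟩
    have hmem : min 1 (dist x e) ∈ A := ⟨e, he, hRe.self_of_nhds, rfl⟩
    have hpos : 0 < sSup A :=
      (lt_min one_pos (dist_pos.2 hex.symm)).trans_le (le_csSup hbdd hmem)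
    obtain ⟨_, ⟨y, hy, hRy, rfl⟩, hlt⟩ := exists_lt_of_lt_csSup ⟨_, hmem⟩ (half_lt_self hpos)
    refine ⟨⟨y, hy⟩, hRy, fun e' he' hRe' ↦ ?_⟩
    have h1 : min 1 (dist x e') ≤ sSup A := le_csSup hbdd ⟨e', he', hRe', rfl⟩
    have h2 := hlt.trans_le (min_le_right _ _)
    simp only
    linarith
  choose F hF1 hF2 using step
  let s : ℕ → U := fun n ↦ F^[n] ⟨p, hp⟩
  have hs : ∀ n, s (n + 1) = F (s n) := fun n ↦ Function.iterate_succ_apply' F n _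
  refine ⟨fun n ↦ (s n).1, rfl, fun n ↦ (s n).2, fun n ↦ ?_, fun q hq hlim ↦ ?_⟩
  · simp only [hs]
    exact hF1 (s n)
  obtain ⟨e, he, heq, hRe⟩ := hR q hq
  have h1 : Filter.Tendsto (fun n ↦ min 1 (dist (s n : X) e)) Filter.atTop
      (𝓝 (min 1 (dist q e))) := tendsto_const_nhds.min (hlim.dist tendsto_const_nhds)
  have h2 : Filter.Tendsto (fun n ↦ 2 * dist (s n : X) (s (n + 1))) Filter.atTop (𝓝 (2 * 0)) := by
    refine Filter.Tendsto.const_mul 2 ?_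
    simpa using hlim.dist (hlim.comp (Filter.tendsto_add_atTop_nat 1))
  have h3 := le_of_tendsto_of_tendsto h1 h2
    ((hlim.eventually hRe).mono fun n hn ↦ by
      simpa only [hs] using hF2 (s n) e he hn)
  have h4 : 0 < min 1 (dist q e) := lt_min one_pos (dist_pos.2 heq.symm)
  linarith

/-- A chain `⋯ ≪ u 1 ≪ u 0`, a timelike curve from `u 0` to `w 0`, and a chain `w 0 ≪ w 1 ≪ ⋯` are
traced by one timelike curve, with control of the sets in which its three parts lie. -/
lemma exists_isTimelikeCurve_of_seqs {M : Type*} [TopologicalSpace M]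
    [ChartedSpace (EuclideanSpace ℝ (Fin 4)) M] [IsManifold (𝓡 4) ∞ M] {g : SpacetimeMetric M}
    {u w : ℕ → M} {U V W : Set M} (hu : ∀ n, g.ChronIn U (u (n + 1)) (u n))
    (h : g.ChronIn V (u 0) (w 0)) (hw : ∀ n, g.ChronIn W (w n) (w (n + 1))) :
    ∃ γ : ℝ → M, g.IsTimelikeCurve γ univ ∧ (∀ n : ℕ, γ (-n) = u n) ∧ (∀ n : ℕ, γ (n + 1) = w n) ∧
      MapsTo γ (Iic 0) U ∧ MapsTo γ (Icc 0 1) V ∧ MapsTo γ (Ici 1) W := by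
  obtain ⟨γ, hγ, hp, hm⟩ := exists_isTimelikeCurve_of_chain (g := g)
    (p := fun n : ℤ ↦ if 0 < n then w (n - 1).toNat else u (-n).toNat)
    (U := fun n : ℤ ↦ if 0 < n then W else if n = 0 then V else U) (by
      intro n
      rcases lt_trichotomy n 0 with hn | rfl | hn
      · obtain ⟨k, rfl⟩ : ∃ k : ℕ, n = -(k + 1) := ⟨(-n - 1).toNat, by omega⟩
        have e1 : ¬ (0 : ℤ) < -(k + 1) := by omega
        have e2 : ¬ (0 : ℤ) < -(k + 1) + 1 := by omega
        have e3 : ¬ (-(k + 1) : ℤ) = 0 := by omega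
        simp only [e1, e2, e3, if_false]
        convert hu k using 2 <;> omega
      · simpa using h
      · obtain ⟨k, rfl⟩ : ∃ k : ℕ, n = k + 1 := ⟨(n - 1).toNat, by omega⟩
        have e1 : (0 : ℤ) < k + 1 := by omega
        have e2 : (0 : ℤ) < k + 1 + 1 := by omega
        simp only [e1, e2, if_true]
        convert hw k using 2 <;> omega)
  refine ⟨γ, hγ, fun n ↦ ?_, fun n ↦ ?_, fun t ht ↦ ?_, ?_, fun t ht ↦ ?_⟩
  · have := hp (-n)
    push_cast at this
    rw [this, if_neg (by omega)]
    simp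
  · have := hp (n + 1)
    push_cast at this
    rw [this, if_pos (by omega)]
    simp
  · have ht0 : t ≤ 0 := ht
    have h1 : ⌈t⌉ ≤ 0 := Int.ceil_le.2 (by simpa using ht0)
    have h2 := hm (⌈t⌉ - 1) (x := t) (by
      push_cast
      exact ⟨by linarith [Int.ceil_lt_add_one t], by linarith [Int.le_ceil t]⟩)
    rwa [if_neg (by omega), if_neg (by omega)] at h2
  · have := hm 0
    simpa using this
  · have ht1 : 1 ≤ t := ht
    have h1 : 1 ≤ ⌊t⌋ := Int.le_floor.2 (by simpa using ht1)
    have h2 := hm ⌊t⌋ (x := t) ⟨Int.floor_le t, (Int.lt_floor_add_one t).le⟩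
    rwa [if_pos (by omega)] at h2

variable {M : Type*} [TopologicalSpace M]

lemma IsFutureEndpoint.tendsto {γ : ℝ → M} {J : Set ℝ} {q : M} (h : IsFutureEndpoint γ J q) {a : ℝ}
    (ha : Ici a ⊆ J) : Filter.Tendsto γ Filter.atTop (𝓝 q) := by
  intro V hV
  obtain ⟨t₀, -, h⟩ := h V hV
  rw [Filter.mem_map]
  filter_upwards [Filter.eventually_ge_atTop (max t₀ a)] with t ht
  exact h t (ha ((le_max_right _ _).trans ht)) ((le_max_left _ _).trans ht)

lemma IsPastEndpoint.tendsto {γ : ℝ → M} {J : Set ℝ} {q : M} (h : IsPastEndpoint γ J q) {a : ℝ}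
    (ha : Iic a ⊆ J) : Filter.Tendsto γ Filter.atBot (𝓝 q) := by
  intro V hV
  obtain ⟨t₀, -, h⟩ := h V hV
  rw [Filter.mem_map]
  filter_upwards [Filter.eventually_le_atBot (min t₀ a)] with t ht
  exact h t (ha (ht.trans (min_le_right _ _))) (ht.trans (min_le_left _ _))

lemma not_isFutureEndpoint_of_seq {γ : ℝ → M} {w : ℕ → M} (hγ : ∀ n : ℕ, γ (n + 1) = w n) {q : M}
    (hw : ¬ Filter.Tendsto w Filter.atTop (𝓝 q)) {J : Set ℝ} {a : ℝ} (ha : Ici a ⊆ J) :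
    ¬ IsFutureEndpoint γ J q := by
  intro h
  refine hw (((h.tendsto ha).comp (Filter.tendsto_atTop_add_const_right _ 1
    tendsto_natCast_atTop_atTop)).congr hγ)

lemma not_tendsto_atBot_of_seq {γ : ℝ → M} {u : ℕ → M} (hγ : ∀ n : ℕ, γ (-n) = u n) {q : M}
    (hu : ¬ Filter.Tendsto u Filter.atTop (𝓝 q)) : ¬ Filter.Tendsto γ Filter.atBot (𝓝 q) := by
  intro h
  exact hu ((h.comp (Filter.tendsto_neg_atTop_atBot.comp
    tendsto_natCast_atTop_atTop)).congr hγ)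

variable [ChartedSpace (EuclideanSpace ℝ (Fin 4)) M] [IsManifold (𝓡 4) ∞ M]
  {g : SpacetimeMetric M}

lemma ChronIn.left_mem {U : Set M} {p q : M} (h : g.ChronIn U p q) : p ∈ U := by
  obtain ⟨γ, a, b, hab, -, hm, rfl, -⟩ := h
  exact hm (left_mem_Icc.2 hab.le)

lemma ChronIn.right_mem {U : Set M} {p q : M} (h : g.ChronIn U p q) : q ∈ U := by
  obtain ⟨γ, a, b, hab, -, hm, -, rfl⟩ := h
  exact hm (right_mem_Icc.2 hab.le)

lemma exists_chronIn_future {U : Set M} (hU : IsOpen U) {p : M} (hp : p ∈ U) :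
    ∃ e, g.ChronIn U p e := by
  obtain ⟨-, -, e, -, -, -, -, h⟩ := g.exists_chronIn_past_future (hU.mem_nhds hp)
  exact ⟨e, h⟩

lemma exists_chronIn_past {U : Set M} (hU : IsOpen U) {p : M} (hp : p ∈ U) :
    ∃ e, g.ChronIn U e p := by
  obtain ⟨e, -, -, -, -, -, h, -⟩ := g.exists_chronIn_past_future (hU.mem_nhds hp)
  exact ⟨e, h⟩

variable [T2Space M] [SecondCountableTopology M]

lemma metrizableSpace (M : Type*) [TopologicalSpace M]
    [ChartedSpace (EuclideanSpace ℝ (Fin 4)) M] [T2Space M] [SecondCountableTopology M] :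
    TopologicalSpace.MetrizableSpace M := by
  have := ChartedSpace.locallyCompactSpace (EuclideanSpace ℝ (Fin 4)) M
  exact Manifold.metrizableSpace (𝓡 4) M

lemma exists_future_seq {U : Set M} (hU : IsOpen U) {p : M} (hp : p ∈ U) :
    ∃ w : ℕ → M, w 0 = p ∧ (∀ n, g.ChronIn U (w n) (w (n + 1))) ∧
      ∀ q ∈ U, ¬ Filter.Tendsto w Filter.atTop (𝓝 q) := by
  have := metrizableSpace M
  obtain ⟨w, h0, -, h1, h2⟩ := exists_seq_without_limit (R := g.ChronIn U) (U := U)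
    (fun q hq ↦ by
      obtain ⟨-, -, e, he, -, hne, -, h⟩ := g.exists_chronIn_past_future (hU.mem_nhds hq)
      exact ⟨e, he, hne, h.eventually_left hU⟩) hp
  exact ⟨w, h0, h1, h2⟩

lemma exists_past_seq {U : Set M} (hU : IsOpen U) {p : M} (hp : p ∈ U) :
    ∃ u : ℕ → M, u 0 = p ∧ (∀ n, g.ChronIn U (u (n + 1)) (u n)) ∧
      ∀ q ∈ U, ¬ Filter.Tendsto u Filter.atTop (𝓝 q) := by
  have := metrizableSpace M
  obtain ⟨u, h0, -, h1, h2⟩ := exists_seq_without_limit (R := fun x y ↦ g.ChronIn U y x) (U := U)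
    (fun q hq ↦ by
      obtain ⟨e, he, -, -, hne, -, h, -⟩ := g.exists_chronIn_past_future (hU.mem_nhds hq)
      exact ⟨e, he, hne, h.eventually_right hU⟩) hp
  exact ⟨u, h0, h1, h2⟩

end SpacetimeMetric

namespace SpacetimeMetric

variable {M : Type*} [TopologicalSpace M] [ChartedSpace (EuclideanSpace ℝ (Fin 4)) M]
  [IsManifold (𝓡 4) ∞ M] {g : SpacetimeMetric M}

/-! ### The complement of the closure of a past set -/

lemma IsTimelikeCurve.tendsto_nhdsGT {γ : ℝ → M} (h : g.IsTimelikeCurve γ univ) (t : ℝ) :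
    Filter.Tendsto γ (𝓝[>] t) (𝓝 (γ t)) := by
  have := IsPiecewiseC1Curve.continuousOn h t (mem_univ t)
  rw [ContinuousWithinAt, nhdsWithin_univ] at this
  exact this.mono_left nhdsWithin_le_nhds

lemma isOpen_chronPast (A : Set M) : IsOpen (g.chronPast A) := by
  refine isOpen_iff_mem_nhds.2 fun x ⟨p, hp, hx⟩ ↦ ?_
  filter_upwards [ChronIn.eventually_left isOpen_univ hx] with y hy
  exact ⟨p, hp, hy⟩

lemma Chron.mem_chronPast {A : Set M} {x y : M} (h : g.Chron x y) (hy : y ∈ g.chronPast A) :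
    x ∈ g.chronPast A := by
  obtain ⟨p, hp, hyp⟩ := hy
  exact ⟨p, hp, h.trans hyp⟩

lemma Chron.mem_chronPast_of_mem_closure {A : Set M} {x y : M} (h : g.Chron x y)
    (hy : y ∈ closure (g.chronPast A)) : x ∈ g.chronPast A := by
  obtain ⟨z, hz, hzA⟩ := mem_closure_iff_nhds.1 hy _ (ChronIn.eventually_right isOpen_univ h)
  exact Chron.mem_chronPast hz hzA

/-- Causal curves do not enter the closure of a past set: a first entry point would be in the
chronological future of points outside of the closure. -/
lemma IsCausalCurve.notMem_closure_chronPast {A : Set M} {γ : ℝ → M} {J : Set ℝ}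
    (hγ : g.IsCausalCurve γ J) {t₀ t : ℝ} (ht₀ : t₀ ∈ J) (ht : t ∈ J) (htt : t₀ ≤ t)
    (h : γ t₀ ∉ closure (g.chronPast A)) : γ t ∉ closure (g.chronPast A) := by
  intro hmem
  set C := closure (g.chronPast A) with hC
  have hJ : Icc t₀ t ⊆ J := hγ.1.out ht₀ ht
  have hcl : IsClosed (Icc t₀ t ∩ γ ⁻¹' C) :=
    ((IsPiecewiseC1Curve.continuousOn hγ).mono hJ).preimage_isClosed_of_isClosed isClosed_Icc
      isClosed_closure
  obtain ⟨c, ⟨hcI, hcC⟩, hmin⟩ := (isCompact_Icc.of_isClosed_subset hcl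
    inter_subset_left).exists_isLeast ⟨t, ⟨htt, le_rfl⟩, hmem⟩
  have htc : t₀ < c := by
    refine hcI.1.lt_of_ne ?_
    rintro rfl
    exact h hcC
  obtain ⟨s, hs, hp⟩ := (hγ.2.2 t₀ ht₀ c (hJ hcI) htc).2
  obtain ⟨s', hs', hW⟩ := exists_chron_of_isC1Piece hs.2 hp
  have hout : γ s' ∉ C := fun hin ↦
    absurd (hmin ⟨⟨hs.1.trans hs'.1, hs'.2.le.trans hcI.2⟩, hin⟩) (not_le.2 hs'.2)
  obtain ⟨x, hx, hxc⟩ := hW _ (isClosed_closure.isOpen_compl.mem_nhds hout)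
  exact hx (subset_closure (hxc.mem_chronPast_of_mem_closure hcC))

/-- Points in the chronological future of a point outside of a past set are outside of its
closure. -/
lemma Chron.notMem_closure_chronPast {A : Set M} {x y : M} (h : g.Chron x y)
    (hx : x ∉ g.chronPast A) : y ∉ closure (g.chronPast A) :=
  fun hy ↦ hx (h.mem_chronPast_of_mem_closure hy)

lemma IsCauchyHypersurface.disjoint {A S : Set M}
    (hS : g.IsCauchyHypersurface (closure (g.chronPast A))ᶜ S) {x : M} (hx : x ∈ S) :
    x ∉ g.chronPast A :=
  fun h ↦ hS.1 hx (subset_closure h)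

/-- A timelike curve from `p` to `q` extends to the past within an open set `U` that contains `p`,
and to the future within an open set `W` that contains `q`, so that it is inextendible in these
sets. -/
lemma ChronIn.exists_extension [T2Space M] [SecondCountableTopology M] {U V W : Set M}
    (hU : IsOpen U) (hW : IsOpen W) {p q : M} (hp : p ∈ U) (hq : q ∈ W) (h : g.ChronIn V p q) :
    ∃ γ : ℝ → M, g.IsTimelikeCurve γ univ ∧ γ 0 = p ∧ γ 1 = q ∧ MapsTo γ (Iic 0) U ∧
      MapsTo γ (Icc 0 1) V ∧ MapsTo γ (Ici 1) W ∧
      (∀ z ∈ U, ¬ Filter.Tendsto γ Filter.atBot (𝓝 z)) ∧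
      (∀ z ∈ W, ∀ (J : Set ℝ) (a : ℝ), Ici a ⊆ J → ¬ IsFutureEndpoint γ J z) := by
  obtain ⟨u, rfl, hu, hu'⟩ := exists_past_seq (g := g) hU hp
  obtain ⟨w, rfl, hw, hw'⟩ := exists_future_seq (g := g) hW hq
  obtain ⟨γ, h1, h2, h3, h4, h5, h6⟩ := exists_isTimelikeCurve_of_seqs hu h hw
  exact ⟨γ, h1, by simpa using h2 0, by simpa using h3 0, h4, h5, h6,
    fun z hz ↦ not_tendsto_atBot_of_seq h2 (hu' z hz),
    fun z hz J a ha ↦ not_isFutureEndpoint_of_seq h3 (hw' z hz) ha⟩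

/-- Points that precede, or follow, a point of the closure of `S` do so for a point of `S`. -/
lemma Achronal.not_chron_closure {S : Set M} (hS : g.Achronal S) {p q : M} (hp : p ∈ closure S)
    (hq : q ∈ S) : ¬ g.Chron p q ∧ ¬ g.Chron q p := by
  refine ⟨fun h ↦ ?_, fun h ↦ ?_⟩
  · obtain ⟨z, hz, hzS⟩ := mem_closure_iff_nhds.1 hp _ (ChronIn.eventually_left isOpen_univ h)
    exact hS z hzS q hq hz
  · obtain ⟨z, hz, hzS⟩ := mem_closure_iff_nhds.1 hp _ (ChronIn.eventually_right isOpen_univ h)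
    exact hS q hq z hzS hz

/-! ### Cauchy hypersurfaces of the complement -/

section Cauchy

variable [T2Space M] [SecondCountableTopology M]

/-- A timelike curve in `V ⊆ N` can be chosen to be a part, on the parameters `[0, 1]`, of an
inextendible timelike curve of `N`, which meets the Cauchy hypersurface exactly once. -/
lemma IsCauchyHypersurface.exists_curve {N S V : Set M} (hN : IsOpen N)
    (hS : g.IsCauchyHypersurface N S) {p q : M} (h : g.ChronIn V p q) (hV : V ⊆ N) :
    ∃ γ : ℝ → M, g.IsTimelikeCurve γ univ ∧ γ 0 = p ∧ γ 1 = q ∧ MapsTo γ (Icc 0 1) V ∧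
      ∃! t, γ t ∈ S := by
  obtain ⟨γ, h1, h2, h3, h4, h5, h6, h7, h8⟩ :=
    h.exists_extension hN hN (hV h.left_mem) (hV h.right_mem)
  refine ⟨γ, h1, h2, h3, h5, ?_⟩
  have hm : MapsTo γ univ N := by
    intro t _
    rcases le_total t 0 with ht | ht
    · exact h4 ht
    · rcases le_total t 1 with ht' | ht'
      · exact hV (h5 ⟨ht, ht'⟩)
      · exact h6 ht'
  simpa using hS.2 γ univ h1.isCausalCurve hm fun z hz ↦
    ⟨h8 z hz univ 0 (subset_univ _), fun he ↦ h7 z hz (he.tendsto (subset_univ (Iic 0)))⟩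

/-- From every boundary point of a past set, a timelike curve starts that meets the Cauchy
hypersurface of the complement of the closure: its part after the starting point is inextendible in
that complement. -/
lemma IsCauchyHypersurface.exists_curve_of_mem_closure {A S : Set M}
    (hS : g.IsCauchyHypersurface (closure (g.chronPast A))ᶜ S) {p : M}
    (hp : p ∈ closure (g.chronPast A)) (hp' : p ∉ g.chronPast A) :
    ∃ γ : ℝ → M, g.IsTimelikeCurve γ univ ∧ γ 0 = p ∧ ∃ t > 0, γ t ∈ S := by
  obtain ⟨e, he⟩ := exists_chronIn_future (g := g) isOpen_univ (mem_univ p)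
  obtain ⟨γ, h1, h2, h3, -, -, -, -, h8⟩ := he.exists_extension isOpen_univ
    (isClosed_closure (s := g.chronPast A)).isOpen_compl (mem_univ p)
    (Chron.notMem_closure_chronPast he hp')
  refine ⟨γ, h1, h2, ?_⟩
  have hγ : g.IsTimelikeCurve γ (Ioi 0) :=
    IsPiecewiseC1Curve.mono h1 (subset_univ _) ordConnected_Ioi
      ((nontrivial_Icc one_lt_two).mono fun t ht ↦ mem_Ioi.2 (one_pos.trans_le ht.1))
  have hm : MapsTo γ (Ioi 0) (closure (g.chronPast A))ᶜ := fun t ht ↦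
    Chron.notMem_closure_chronPast (h1.chron (mem_univ 0) (mem_univ t) ht) (by rwa [h2])
  have hpast : ∀ z ∈ (closure (g.chronPast A))ᶜ, ¬ IsPastEndpoint γ (Ioi 0) z := by
    intro z hz he
    have hlim : Filter.Tendsto γ (𝓝[>] 0) (𝓝 z) := by
      intro V hV
      obtain ⟨t₀, ht₀, h⟩ := he V hV
      rw [Filter.mem_map]
      filter_upwards [Ioc_mem_nhdsGT ht₀] with t ht
      exact h t ht.1 ht.2
    exact hz (tendsto_nhds_unique hlim (h2 ▸ h1.tendsto_nhdsGT 0) ▸ hp)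
  obtain ⟨t, ⟨ht, htS⟩, -⟩ := hS.2 γ (Ioi 0) hγ.isCausalCurve hm fun z hz ↦
    ⟨h8 z hz _ 1 fun t ht ↦ mem_Ioi.2 (one_pos.trans_le ht), hpast z hz⟩
  exact ⟨t, ht, htS⟩

lemma IsCauchyHypersurface.achronal {A S : Set M}
    (hS : g.IsCauchyHypersurface (closure (g.chronPast A))ᶜ S) : g.Achronal S := by
  intro p hp q hq h
  obtain ⟨γ, a, b, hab, hγ, -, rfl, rfl⟩ := h
  have hm : MapsTo γ (Icc a b) (closure (g.chronPast A))ᶜ := fun t ht ↦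
    hγ.isCausalCurve.notMem_closure_chronPast (left_mem_Icc.2 hab.le) ht ht.1 (hS.1 hp)
  obtain ⟨δ, -, h0, h1, -, t, -, ht⟩ := hS.exists_curve isClosed_closure.isOpen_compl
    ⟨γ, a, b, hab, hγ, hm, rfl, rfl⟩ subset_rfl
  have e0 := ht 0 (by simpa only [h0] using hp)
  have e1 := ht 1 (by simpa only [h1] using hq)
  exact zero_ne_one (e0.trans e1.symm)

lemma IsCauchyHypersurface.closure_subset {A S : Set M}
    (hS : g.IsCauchyHypersurface (closure (g.chronPast A))ᶜ S) : closure S ⊆ S := by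
  intro q hq
  have hac := hS.achronal
  by_cases hqN : q ∈ closure (g.chronPast A)
  · have hqP : q ∉ g.chronPast A := by
      intro h
      obtain ⟨z, hz, hzS⟩ := mem_closure_iff_nhds.1 hq _ ((isOpen_chronPast A).mem_nhds h)
      exact hS.disjoint hzS hz
    obtain ⟨γ, hγ, rfl, t, ht, htS⟩ := hS.exists_curve_of_mem_closure hqN hqP
    exact absurd (hγ.chron (mem_univ 0) (mem_univ t) ht) (hac.not_chron_closure hq htS).1
  · obtain ⟨e, he⟩ := exists_chronIn_future (g := g)
      (isClosed_closure (s := g.chronPast A)).isOpen_compl hqN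
    obtain ⟨γ, hγ, rfl, -, -, t, htS, -⟩ := hS.exists_curve isClosed_closure.isOpen_compl he
      subset_rfl
    rcases lt_trichotomy t 0 with ht | rfl | ht
    · exact absurd (hγ.chron (mem_univ t) (mem_univ 0) ht) (hac.not_chron_closure hq htS).2
    · exact htS
    · exact absurd (hγ.chron (mem_univ 0) (mem_univ t) ht) (hac.not_chron_closure hq htS).1

lemma IsCauchyHypersurface.edge_eq_empty {A S : Set M}
    (hS : g.IsCauchyHypersurface (closure (g.chronPast A))ᶜ S) : g.edge S = ∅ := by
  have hac := hS.achronal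
  refine eq_empty_of_forall_notMem fun q ⟨hq, hU⟩ ↦ ?_
  have hqS := hS.closure_subset hq
  have hN := (isClosed_closure (s := g.chronPast A)).isOpen_compl
  obtain ⟨x, y, hxq, hqy, hxy⟩ := hU _ (hN.mem_nhds (hS.1 hqS))
  obtain ⟨γ, hγ, rfl, rfl, hm, t, htS, -⟩ := hS.exists_curve hN hxy sdiff_subset
  rcases lt_or_ge t 0 with ht | ht
  · exact hac _ htS _ hqS ((hγ.chron (mem_univ t) (mem_univ 0) ht).trans hxq.chron)
  rcases le_or_gt t 1 with ht' | ht'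
  · exact (hm ⟨ht, ht'⟩).2 htS
  · exact hac _ hqS _ htS (hqy.chron.trans (hγ.chron (mem_univ 1) (mem_univ t) ht'))

/-- In the complement of the closure of a past set, the chronological past of the Cauchy
hypersurface belongs to its past domain of dependence in `M`: causal curves do not leave the
complement towards the future. -/
lemma IsCauchyHypersurface.mem_pastDependence {A S : Set M}
    (hS : g.IsCauchyHypersurface (closure (g.chronPast A))ᶜ S) {x s : M}
    (hx : x ∉ closure (g.chronPast A)) (hs : s ∈ S) (hxs : g.Chron x s) :
    x ∈ g.pastDependence S := by
  rintro γ J a ha rfl hγ hend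
  have hN := (isClosed_closure (s := g.chronPast A)).isOpen_compl
  obtain ⟨e, he⟩ := exists_chronIn_future (g := g) hN hx
  obtain ⟨δ, h1, h2, -, h4, -, -, h7, -⟩ := he.exists_extension hN hN hx he.right_mem
  have hδ : g.IsTimelikeCurve (fun t ↦ δ (1 * t + (-a))) (Iic a) :=
    IsPiecewiseC1Curve.comp_affine (fun x v c hc ↦ FutureTimelike.smul hc) one_pos ordConnected_Iic
      ((nontrivial_Icc (sub_one_lt a)).mono Icc_subset_Iic_self) (mapsTo_univ _ _) h1
  simp only [one_mul, ← sub_eq_add_neg] at hδ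
  have hglue : g.IsCausalCurve _ (Iic a ∪ J) := IsPiecewiseC1Curve.glue hδ.isCausalCurve hγ
    isGreatest_Iic ha (by simp [h2])
  have hm : MapsTo (fun t ↦ if t ≤ a then δ (t - a) else γ t) (Iic a ∪ J)
      (closure (g.chronPast A))ᶜ := by
    intro t ht
    by_cases hta : t ≤ a
    · simp only [hta, if_true]
      exact h4 (sub_nonpos.2 hta)
    · simp only [hta, if_false]
      have htJ : t ∈ J := ht.resolve_left hta
      exact hγ.notMem_closure_chronPast ha.1 htJ (ha.2 htJ) hx
  have hends : ∀ z ∈ (closure (g.chronPast A))ᶜ,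
      ¬ IsFutureEndpoint (fun t ↦ if t ≤ a then δ (t - a) else γ t) (Iic a ∪ J) z ∧
      ¬ IsPastEndpoint (fun t ↦ if t ≤ a then δ (t - a) else γ t) (Iic a ∪ J) z := by
    refine fun z hz ↦ ⟨fun he ↦ ?_, fun he ↦ ?_⟩
    · refine hend z fun V hV ↦ ?_
      obtain ⟨t₀, ht₀, h⟩ := he V hV
      have key : ∀ t ∈ J, t₀ ≤ t → γ t ∈ V := by
        intro t ht htt
        have := h t (Or.inr ht) htt
        by_cases hta : t ≤ a
        · have e : t = a := le_antisymm hta (ha.2 ht)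
          simpa [e, h2] using this
        · simpa [hta] using this
      rcases le_or_gt t₀ a with h' | h'
      · exact ⟨a, ha.1, fun t ht _ ↦ key t ht (h'.trans (ha.2 ht))⟩
      · exact ⟨t₀, ht₀.resolve_left (not_le.2 h'), key⟩
    · have h3 := he.tendsto (a := a) subset_union_left
      have h5 : Filter.Tendsto (fun t ↦ δ (t - a)) Filter.atBot (𝓝 z) := by
        refine h3.congr' ?_
        filter_upwards [Filter.eventually_le_atBot a] with t ht
        simp [ht]
      refine h7 z hz ((h5.comp (Filter.tendsto_atBot_add_const_right _ a Filter.tendsto_id)).congr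
        fun t ↦ ?_)
      simp
  obtain ⟨t, ⟨htJ, htS⟩, -⟩ := hS.2 _ _ hglue hm hends
  by_cases hta : t ≤ a
  · simp only [hta, if_true] at htS
    rcases hta.eq_or_lt with rfl | hlt
    · rw [sub_self, h2] at htS
      exact ⟨t, ha.1, htS⟩
    · have := h1.chron (mem_univ (t - a)) (mem_univ 0) (sub_neg.2 hlt)
      rw [h2] at this
      exact absurd (this.trans hxs) (hS.achronal _ htS _ hs)
  · simp only [hta, if_false] at htS
    exact ⟨t, htJ.resolve_left hta, htS⟩

/-- Every point of `D⁻(S)` lies in `S` or in its chronological past. -/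
lemma exists_mem_of_mem_pastDependence {S : Set M} {d y : M} (hd : d ∈ g.pastDependence S)
    (hy : g.Chron y d) : ∃ s ∈ S, g.Chron y s := by
  obtain ⟨e, he⟩ := exists_chronIn_future (g := g) isOpen_univ (mem_univ d)
  obtain ⟨γ, h1, rfl, -, -, -, -, -, h8⟩ := he.exists_extension isOpen_univ isOpen_univ
    (mem_univ d) (mem_univ e)
  obtain ⟨t, ht, htS⟩ := hd γ (Ici 0) 0 isLeast_Ici rfl
    (IsTimelikeCurve.isCausalCurve (IsPiecewiseC1Curve.mono h1 (subset_univ _) ordConnected_Ici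
      ((nontrivial_Icc zero_lt_one).mono Icc_subset_Ici_self)))
    (fun z ↦ h8 z (mem_univ z) _ 0 subset_rfl)
  rcases (mem_Ici.1 ht).eq_or_lt with rfl | ht
  · exact ⟨_, htS, hy⟩
  · exact ⟨_, htS, hy.trans (h1.chron (mem_univ 0) (mem_univ t) ht)⟩

/-- The past horizon of the Cauchy hypersurface is the boundary of the past set, provided that
`D⁻(S)` does not reach into the past set. -/
lemma IsCauchyHypersurface.pastHorizon_eq_frontier {A S : Set M}
    (hS : g.IsCauchyHypersurface (closure (g.chronPast A))ᶜ S)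
    (hD : Disjoint (g.pastDependence S) (g.chronPast A)) :
    g.pastHorizon S = frontier (g.chronPast A) := by
  have hN := (isClosed_closure (s := g.chronPast A)).isOpen_compl
  rw [(isOpen_chronPast A).frontier_eq]
  ext p
  constructor
  · rintro ⟨hp, hpI⟩
    refine ⟨by_contra fun hpN ↦ ?_, fun hpP ↦ ?_⟩
    · obtain ⟨y, hy⟩ := exists_chronIn_past (g := g) hN hpN
      obtain ⟨d, hyd, hdD⟩ := mem_closure_iff_nhds.1 hp _
        (ChronIn.eventually_right isOpen_univ hy.chron)
      obtain ⟨s, hs, hys⟩ := exists_mem_of_mem_pastDependence hdD hyd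
      exact hpI ⟨y, hS.mem_pastDependence hy.left_mem hs hys, hy.chron⟩
    · obtain ⟨d, hdP, hdD⟩ := mem_closure_iff_nhds.1 hp _ ((isOpen_chronPast A).mem_nhds hpP)
      exact hD.notMem_of_mem_left hdD hdP
  · rintro ⟨hp, hpP⟩
    refine ⟨?_, fun ⟨d, hdD, hdp⟩ ↦
      hD.notMem_of_mem_left hdD (hdp.mem_chronPast_of_mem_closure hp)⟩
    obtain ⟨γ, hγ, rfl, t, ht, htS⟩ := hS.exists_curve_of_mem_closure hp hpP
    refine mem_closure_of_tendsto (hγ.tendsto_nhdsGT 0) ?_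
    filter_upwards [Ioo_mem_nhdsGT ht] with u hu
    exact hS.mem_pastDependence (Chron.notMem_closure_chronPast
      (hγ.chron (mem_univ 0) (mem_univ u) hu.1) hpP) htS
      (hγ.chron (mem_univ u) (mem_univ t) hu.2)

/-- From a point of the past of a chronology violating class, a future inextendible timelike curve
may run to the class and circle there forever, and so never leave the past of the class. -/
lemma disjoint_pastDependence_chronPast {r : M} (hr : g.Chron r r) {S : Set M}
    (hS : Disjoint S (g.chronPast (g.chronClass r))) :
    Disjoint (g.pastDependence S) (g.chronPast (g.chronClass r)) := by
  rw [Set.disjoint_left]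
  rintro d hd ⟨c, hc, hdc⟩
  have hdr : g.Chron d r := hdc.trans hc.2
  have hop : g.chronClass r ∈ 𝓝 r :=
    (ChronIn.eventually_right isOpen_univ hr).and (ChronIn.eventually_left isOpen_univ hr)
  -- A second point `e` of the class: a curve that visits both `r` and `e` again and again has no
  -- endpoint.
  obtain ⟨-, -, e, he, -, hne, -, -⟩ := g.exists_chronIn_past_future hop
  obtain ⟨u, rfl, hu, -⟩ := exists_past_seq (g := g) isOpen_univ (mem_univ d)
  obtain ⟨γ, h1, h2, h3, -⟩ := exists_isTimelikeCurve_of_seqs (g := g) (V := univ) (W := univ)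
    (w := fun n ↦ if Even n then r else e) hu (by rw [if_pos Even.zero]; exact hdr) (by
      intro n
      by_cases hn : Even n
      · have : ¬ Even (n + 1) := by simpa [Nat.even_add_one] using hn
        simp only [hn, this, if_true, if_false]
        exact he.1
      · have : Even (n + 1) := by simpa [Nat.even_add_one] using hn
        simp only [hn, this, if_true, if_false]
        exact he.2)
  have h20 : γ 0 = u 0 := by simpa using h2 0
  have hlim : ∀ z, ¬ Filter.Tendsto (fun n : ℕ ↦ if Even n then r else e) Filter.atTop (𝓝 z) := by
    intro z hz
    have e1 : Filter.Tendsto (fun n : ℕ ↦ 2 * n) Filter.atTop Filter.atTop :=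
      Filter.tendsto_id.const_mul_atTop' two_pos
    have l1 := hz.comp e1
    have l2 := hz.comp ((Filter.tendsto_add_atTop_nat 1).comp e1)
    have l1' : Filter.Tendsto (fun _ : ℕ ↦ r) Filter.atTop (𝓝 z) :=
      l1.congr fun n ↦ by simp
    have l2' : Filter.Tendsto (fun _ : ℕ ↦ e) Filter.atTop (𝓝 z) :=
      l2.congr fun n ↦ by simp
    exact hne ((tendsto_nhds_unique tendsto_const_nhds l2').trans
      (tendsto_nhds_unique tendsto_const_nhds l1').symm)
  obtain ⟨t, ht, htS⟩ := hd γ (Ici 0) 0 isLeast_Ici h20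
    (IsTimelikeCurve.isCausalCurve (IsPiecewiseC1Curve.mono h1 (subset_univ _) ordConnected_Ici
      ((nontrivial_Icc zero_lt_one).mono Icc_subset_Ici_self)))
    (fun z ↦ not_isFutureEndpoint_of_seq h3 (hlim z) subset_rfl)
  obtain ⟨n, hn⟩ := exists_nat_gt t
  have h4 : γ ((2 * n : ℕ) + 1) = r := by rw [h3]; simp
  have h5 := h1.chron (mem_univ t) (mem_univ (((2 * n : ℕ) : ℝ) + 1)) (by
    push_cast
    have : (0 : ℝ) ≤ n := n.cast_nonneg
    linarith)
  rw [h4] at h5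
  exact hS.notMem_of_mem_left htS ⟨r, ⟨hr, hr⟩, h5⟩

end Cauchy

/-- If every point is in the future of the class, the class is its own chronological past. -/
lemma chronPast_chronClass {r : M} (hr : g.Chron r r)
    (h : g.chronFuture (g.chronClass r) = univ) :
    g.chronPast (g.chronClass r) = g.chronClass r := by
  ext x
  constructor
  · rintro ⟨c, hc, hxc⟩
    obtain ⟨c', hc', hcx⟩ : x ∈ g.chronFuture (g.chronClass r) := h ▸ mem_univ x
    exact ⟨hc'.1.trans hcx, hxc.trans hc.2⟩
  · rintro ⟨-, hx⟩
    exact ⟨r, ⟨hr, hr⟩, hx⟩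

end SpacetimeMetric

theorem mainTheorem4 {M : Type*} [TopologicalSpace M] [T2Space M] [SecondCountableTopology M]
    [ChartedSpace (EuclideanSpace ℝ (Fin 4)) M] [IsManifold (𝓡 4) ∞ M]
    (g : SpacetimeMetric M) (r : M) (hr : g.Chron r r)
    (hN : g.IsGloballyHyperbolic (closure (g.chronPast (g.chronClass r)))ᶜ) (S : Set M)
    (hS : g.IsCauchyHypersurface (closure (g.chronPast (g.chronClass r)))ᶜ S) :
    (g.Achronal S ∧ g.edge S = ∅) ∧
    g.pastHorizon S = frontier (g.chronPast (g.chronClass r)) ∧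
    (g.chronFuture (g.chronClass r) = univ →
      g.pastHorizon S = frontier (g.chronClass r) ∧
      frontier (g.chronClass r) = g.futureBoundary r) := by
  have hD := SpacetimeMetric.disjoint_pastDependence_chronPast hr
    (Set.disjoint_left.2 fun x hx ↦ hS.disjoint hx)
  have hH := hS.pastHorizon_eq_frontier hD
  refine ⟨⟨hS.achronal, hS.edge_eq_empty⟩, hH, fun hfut ↦ ?_⟩
  have hP := SpacetimeMetric.chronPast_chronClass hr hfut
  have hop := SpacetimeMetric.isOpen_chronPast (g := g) (g.chronClass r)
  refine ⟨by rw [hH, hP], ?_⟩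
  rw [SpacetimeMetric.futureBoundary, hP]
  rw [hP] at hop
  exact hop.frontier_eq
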